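/- For $m,\omega>0$ and $t\in\mathbb R$ let $$\varphi^{m,\omega}_t(x,p)=\Big(x\cos\omega t+\tfrac{p}{m\omega}\sin\omega t,\; -m\omega x\sin\omega t+p\cos\omega t\Big)$$ be the flow of the classical harmonic oscillator on $\mathbb R^2$. For $\hbar>0$ let $H^\hbar_{m,\omega}=-\frac{\hbar^2}{2m}\frac{\partial^2}{\partial x^2}+\frac12 m\omega^2x^2$ on $L^2(\mathbb R)$, and for $\Psi\in L^2(\mathbb R)$ let $\Psi^\hbar_{m,\omega}(t)=e^{-iH^\hbar_{m,\omega}t/\hbar}\Psi$ and $$W^\Psi_\hbar(x,p)=\frac1{\pi\hbar}\int_{\mathbb R}\overline{\Psi(x+y)}\,\Psi(x-y)\,e^{2ipy/\hbar}\,dy\in\mathbb R ,$$ the Wigner function of $\Psi$. Let $\omega$ and $m$ be real random variables on a common probability space such that $m\omega=c$ almost surely for a constant $c>0$, and such that the law of $\omega$ has a density with respect to Lebesgue measure on $(0,\infty)$. Let $(\Psi_\hbar)_{\hbar>0}$ be a family in $L^2(\mathbb R)$ (an initial state, whose wave function may depend on $\hbar$) that has as its classical limit a probability measure $\mu_0$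 on $\mathbb R^2$, that is, $$\lim_{\hbar\to0^+}\int_{\mathbb R^2} f\,W_\hbar^{\Psi_\hbar}\,dx\,dp=\int_{\mathbb R^2} f\,d\mu_0\qquad\text{for all } f\in C_c^\infty(\mathbb R^2),$$ and suppose that $d\mu_0=W_0\,dx\,dp$ for a density $W_0\ge 0$. Write $\Psi^\hbar_{m,\omega}(t)=e^{-iH^\hbar_{m,\omega}t/\hbar}\Psi_\hbar$. Then for all $\hbar>0$, $t\in\mathbb R$ and $(x,p)\in\mathbb R^2$ the random variable $W_\hbar^{\Psi^\hbar_{m,\omega}(t)}(x,p)$ is integrable, and $$\lim_{\hbar\to0^+}\ \lim_{t\to\infty}\ \mathbb E_{\omega}\Big[W_\hbar^{\Psi^\hbar_{m,\omega}(t)}(x,p)\Big]=\frac1{2\pi}\int_0^{2\pi}W_0\big(\varphi^{c,1}_s(x,p)\big)\,ds$$ in the weak* topology (convergence of the integrals against every $f\in C_c^\infty(\mathbb R^2)$), where $\varphi^{c,1}$ is the flow of the oscillator of frequency $1$ and mass $c$, so that $m\omega$ has the same value $c$. More precisely, for every $\hbar>0$ there is a locally integrable function $V_\hbar$ on $\mathbb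 R^2$ such that $\mathbb E_\omega\big[W_\hbar^{\Psi^\hbar_{m,\omega}(t)}\big]\to V_\hbar$ in the weak* topology as $t\to\infty$, and $V_\hbar$ converges in the weak* topology, as $\hbar\to0^+$, to the right-hand side, which is locally integrable. -/

import Mathlib

open MeasureTheory ProbabilityTheory Filter Topology Set
open scoped SchwartzMap ComplexConjugate

namespace QHO

/-- The Hilbert space `L²(ℝ)` of (classes of) complex wave functions. -/
abbrev L2R : Type := Lp ℂ 2 (volume : Measure ℝ)

/-! ### The classical oscillator -/

/-- The flow of the classical harmonic oscillator with mass `m` and frequency `ω`: the phase space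
point reached at time `t` from the initial point `z = (x, p)`. -/
noncomputable def oscFlow (m ω t : ℝ) (z : ℝ × ℝ) : ℝ × ℝ :=
  (z.1 * Real.cos (ω * t) + z.2 / (m * ω) * Real.sin (ω * t),
    -(m * ω * z.1 * Real.sin (ω * t)) + z.2 * Real.cos (ω * t))

theorem oscFlow_zero (m ω : ℝ) (z : ℝ × ℝ) : oscFlow m ω 0 z = z := by
  simp [oscFlow]

/-- First Hamilton equation, `x' = p / m`. -/
theorem hasDerivAt_oscFlow_fst {m ω : ℝ} (hm : m ≠ 0) (hω : ω ≠ 0) (t : ℝ) (z : ℝ × ℝ) :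
    HasDerivAt (fun s => (oscFlow m ω s z).1) ((oscFlow m ω t z).2 / m) t := by
  have hl : HasDerivAt (fun s : ℝ => ω * s) ω t := by
    simpa using (hasDerivAt_id t).const_mul ω
  have h := (hl.cos.const_mul z.1).add (hl.sin.const_mul (z.2 / (m * ω)))
  refine h.congr_deriv ?_
  simp only [oscFlow]
  field_simp

/-- Second Hamilton equation, `p' = -m ω² x`. -/
theorem hasDerivAt_oscFlow_snd {m ω : ℝ} (hm : m ≠ 0) (hω : ω ≠ 0) (t : ℝ) (z : ℝ × ℝ) :
    HasDerivAt (fun s => (oscFlow m ω s z).2) (-(m * ω ^ 2 * (oscFlow m ω t z).1)) t := by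
  have hl : HasDerivAt (fun s : ℝ => ω * s) ω t := by
    simpa using (hasDerivAt_id t).const_mul ω
  have h := ((hl.sin.const_mul (m * ω * z.1)).neg).add (hl.cos.const_mul z.2)
  refine h.congr_deriv ?_
  simp only [oscFlow]
  field_simp
  ring

/-- The average of a phase space function over one period `2π` of the oscillator of unit frequency
whose product of mass and frequency is `c`, that is, of mass `c`. -/
noncomputable def orbitAverage (c : ℝ) (F : ℝ × ℝ → ℝ) (z : ℝ × ℝ) : ℝ :=
  (2 * Real.pi)⁻¹ * ∫ s in (0 : ℝ)..(2 * Real.pi), F (oscFlow c 1 s z)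

/-! ### The quantum oscillator -/

/-- The Hamiltonian `-(ħ²/2m) ∂²/∂x² + (1/2) m ω² x²` on the Schwartz space. -/
noncomputable def hamiltonian (ħ m ω : ℝ) (φ : 𝓢(ℝ, ℂ)) : 𝓢(ℝ, ℂ) :=
  -((ħ ^ 2 / (2 * m)) • SchwartzMap.derivCLM ℂ ℂ (SchwartzMap.derivCLM ℂ ℂ φ))
    + (m * ω ^ 2 / 2) • SchwartzMap.smulLeftCLM ℂ (fun x : ℝ => x ^ 2) φ

theorem hamiltonian_apply (ħ m ω : ℝ) (φ : 𝓢(ℝ, ℂ)) (x : ℝ) :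
    hamiltonian ħ m ω φ x =
      -((ħ ^ 2 / (2 * m) : ℝ) * iteratedDeriv 2 φ x) + (m * ω ^ 2 / 2 * x ^ 2 : ℝ) * φ x := by
  have h : (fun x : ℝ => x ^ 2).HasTemperateGrowth := by fun_prop
  have hd : ∀ ψ : 𝓢(ℝ, ℂ), (SchwartzMap.derivCLM ℂ ℂ ψ : ℝ → ℂ) = deriv ψ := fun ψ => by
    ext y; simp
  have e : iteratedDeriv 2 φ x = deriv (deriv φ) x := by
    rw [iteratedDeriv_succ, iteratedDeriv_one]
  simp only [hamiltonian, add_apply, neg_apply, smul_apply,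
    SchwartzMap.smulLeftCLM_apply_apply h, hd, e, Complex.real_smul]
  push_cast
  ring

/-- `U` is the unitary group `t ↦ exp (-i t H / ħ)` on `L²(ℝ)`: a strongly continuous one-parameter
group of unitaries whose infinitesimal generator is `-(i/ħ) H` on Schwartz functions. Since `H` is
essentially self-adjoint on the Schwartz space (for `ħ, m, ω > 0`), there is exactly one such group,
and its generator is `-(i/ħ)` times the self-adjoint closure of `H`. -/
structure IsSchrodingerGroup (ħ m ω : ℝ) (U : ℝ → (L2R ≃ₗᵢ[ℂ] L2R)) : Prop where
  map_zero : ∀ Ψ : L2R, U 0 Ψ = Ψ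
  map_add : ∀ (s t : ℝ) (Ψ : L2R), U (s + t) Ψ = U s (U t Ψ)
  continuous : ∀ Ψ : L2R, Continuous fun t => U t Ψ
  hasDerivAt : ∀ φ : 𝓢(ℝ, ℂ),
    HasDerivAt (fun t => U t (φ.toLp 2 volume))
      ((-(Complex.I / ħ)) • ((hamiltonian ħ m ω φ).toLp 2 volume)) 0

/-- The time evolution `exp (-i t H / ħ)` of the quantum harmonic oscillator with mass `m` and
frequency `ω`. -/
noncomputable def evolution (ħ m ω : ℝ) : ℝ → (L2R ≃ₗᵢ[ℂ] L2R) :=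
  Classical.epsilon (IsSchrodingerGroup ħ m ω)

/-- The integral defining the Wigner function, normalized so that its integral against a test
function `f` is the expectation value of the Weyl quantization of `f` in the state `Ψ`. -/
noncomputable def wignerC (ħ : ℝ) (Ψ : L2R) (z : ℝ × ℝ) : ℂ :=
  ((Real.pi * ħ)⁻¹ : ℝ) * ∫ y : ℝ, conj (Ψ (z.1 + y)) * Ψ (z.1 - y) *
    Complex.exp (2 * Complex.I * z.2 * y / ħ)

theorem wignerC_im (ħ : ℝ) (Ψ : L2R) (z : ℝ × ℝ) : (wignerC ħ Ψ z).im = 0 := by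
  rw [← Complex.conj_eq_iff_im, wignerC, map_mul, Complex.conj_ofReal, ← integral_conj,
    ← integral_neg_eq_self]
  congr 2
  ext y
  simp only [map_mul, Complex.conj_conj, ← Complex.exp_conj, map_div₀, Complex.conj_ofReal,
    Complex.conj_I, map_ofNat, map_neg, sub_neg_eq_add, Complex.ofReal_neg, ← sub_eq_add_neg]
  rw [mul_comm (Ψ (z.1 - y))]
  congr 2
  ring

/-- The (real-valued) Wigner function of the state `Ψ`. -/
noncomputable def wigner (ħ : ℝ) (Ψ : L2R) (z : ℝ × ℝ) : ℝ := (wignerC ħ Ψ z).re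

/-! ### Weak* limits -/

/-- Smooth compactly supported functions on phase space. -/
def IsTest (f : ℝ × ℝ → ℝ) : Prop := ContDiff ℝ ((⊤ : ℕ∞) : WithTop ℕ∞) f ∧ HasCompactSupport f

/-- Weak* convergence of the densities `F i` to the density `G`, tested against smooth compactly
supported functions. -/
def WeakStarTendsto {ι : Type*} (F : ι → ℝ × ℝ → ℝ) (l : Filter ι) (G : ℝ × ℝ → ℝ) : Prop :=
  (∀ᶠ i in l, LocallyIntegrable (F i)) ∧ LocallyIntegrable G ∧
    ∀ f : ℝ × ℝ → ℝ, IsTest f →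
      Tendsto (fun i => ∫ z, f z * F i z) l (𝓝 (∫ z, f z * G z))

/-- The probability measure `μ` on phase space is the classical limit, as `ħ → 0⁺`, of the state
given by the wave functions `Ψ ħ`. -/
def IsClassicalLimit (Ψ : ℝ → L2R) (μ : Measure (ℝ × ℝ)) : Prop :=
  IsProbabilityMeasure μ ∧
    ∀ f : ℝ × ℝ → ℝ, IsTest f →
      Tendsto (fun ħ : ℝ => ∫ z, f z * wigner ħ (Ψ ħ) z) (𝓝[>] 0) (𝓝 (∫ z, f z ∂μ))

end QHO

namespace QHO

/-! For a quadratic Hamiltonian the quantum dynamics is exactly classical on phase space. The Wigner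
function at `z` is `(πħ)⁻¹ ⟨Ψ, Π_z Ψ⟩`, where `Π_z` is the unitary reflection at `z`
(`wignerC_eq_inner`), and the evolution conjugates `Π_z` into the reflection at the point to which
the classical flow carries `z` (`evolution_parity`). So the Wigner function is simply transported by
the flow (`wigner_evolution`). Both facts about operators are checked on Gaussian coherent states:
they span a dense subspace of `L²`, and evolution and reflections act on them by explicit formulas.
The same formulas construct the Schrödinger group and determine it.

Since `m * ω = c`, the flow at time `t` is the flow of frequency `1` at time `ω * t`, so the only
randomness left is an angle. The law of `ω` is absolutely continuous, so by Riemann–Lebesgue this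
angle equidistributes modulo `2π` (`tendsto_integral_periodic`), and the expectation converges
pointwise to the orbit average of the initial Wigner function. The bound `‖Ψ‖² / (πħ)` makes this
weak* convergence.

For `ħ → 0⁺`, Liouville's theorem makes orbit averaging self-adjoint (`integral_mul_orbitAverage`),
and it preserves test functions (`IsTest.orbitAverage`). Moving the average onto the test function
reduces the claim to the assumed classical limit of the initial states. -/

/-! ### Coherent states -/

/-- The (unnormalized) coherent state with parameter `α`, as a function. -/
noncomputable def cohFun (k : ℝ) (α : ℂ) (x : ℝ) : ℂ :=
  -- The constant term makes the inner product of two such states depend on `conj α * β` alone, and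
  -- makes the oscillator act by rotating `α`, up to the phase `exp (-iωt/2)`.
  Complex.exp (-(k / 2) * x ^ 2 + α * x - α ^ 2 / (4 * k))

theorem contDiff_cohFun (k : ℝ) (α : ℂ) {n : WithTop ℕ∞} : ContDiff ℝ n (cohFun k α) := by
  unfold cohFun
  have : ContDiff ℝ n (fun x : ℝ => (x : ℂ)) := Complex.ofRealCLM.contDiff
  fun_prop

theorem hasDerivAt_cohFun (k : ℝ) (α : ℂ) (x : ℝ) :
    HasDerivAt (cohFun k α) ((α - k * x) * cohFun k α x) x := by
  have hx : HasDerivAt (fun x : ℝ => (x : ℂ)) 1 x := Complex.ofRealCLM.hasDerivAt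
  have h := (((hx.pow 2).const_mul (-(k / 2) : ℂ)).add (hx.const_mul α)).sub_const
    (α ^ 2 / (4 * k))
  refine h.cexp.congr_deriv ?_
  simp only [cohFun, Pi.add_apply, Pi.pow_apply]
  push_cast
  ring

theorem norm_cohFun (k : ℝ) (α : ℂ) (x : ℝ) :
    ‖cohFun k α x‖ =
      Real.exp (-(α ^ 2 / (4 * k)).re) * Real.exp (-(k / 2) * x ^ 2 + α.re * x) := by
  rw [cohFun, Complex.norm_exp, ← Real.exp_add]
  congr 1
  have : (-(k / 2 : ℂ) * x ^ 2).re = -(k / 2) * x ^ 2 := by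
    rw [← Complex.ofReal_re (-(k / 2) * x ^ 2)]
    push_cast
    rfl
  simp only [Complex.sub_re, Complex.add_re, Complex.re_mul_ofReal, this]
  ring

/-- A quadratic exponent is bounded after removing a linear one. -/
theorem neg_sq_add_le {k : ℝ} (hk : 0 < k) (a x : ℝ) :
    -(k / 2) * x ^ 2 + a * x ≤ a ^ 2 / (2 * k) := by
  rw [le_div_iff₀ (by positivity)]
  nlinarith [sq_nonneg (k * x - a)]

theorem pow_mul_norm_cohFun_le {k : ℝ} (hk : 0 < k) (α : ℂ) (n : ℕ) :
    ∃ C, ∀ x, |x| ^ n * ‖cohFun k α x‖ ≤ C := by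
  refine ⟨n.factorial * (Real.exp (-(α ^ 2 / (4 * k)).re) *
    Real.exp ((1 + |α.re|) ^ 2 / (2 * k))), fun x => ?_⟩
  have h1 : |x| ^ n ≤ n.factorial * Real.exp |x| := by
    have := Real.pow_div_factorial_le_exp |x| (abs_nonneg x) n
    rwa [div_le_iff₀ (by positivity), mul_comm] at this
  rw [norm_cohFun]
  calc _ ≤ (n.factorial * Real.exp |x|) * (Real.exp (-(α ^ 2 / (4 * k)).re) *
        Real.exp (-(k / 2) * x ^ 2 + α.re * x)) := by gcongr
    _ = n.factorial * (Real.exp (-(α ^ 2 / (4 * k)).re) *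
        Real.exp (|x| + (-(k / 2) * x ^ 2 + α.re * x))) := by
      rw [Real.exp_add |x|]; ring
    _ ≤ _ := by
      gcongr
      have h2 := neg_sq_add_le hk (1 + |α.re|) |x|
      have h3 : α.re * x ≤ |α.re| * |x| := by rw [← abs_mul]; exact le_abs_self _
      rw [sq_abs] at h2
      linarith

/-- Polynomial factors are harmless against the Gaussian, so this form of the derivatives yields
Schwartz decay. -/
theorem iteratedDeriv_cohFun (k : ℝ) (α : ℂ) (n : ℕ) :
    ∃ p : Polynomial ℂ, ∀ x : ℝ,
      iteratedDeriv n (cohFun k α) x = p.eval (x : ℂ) * cohFun k α x := by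
  induction n with
  | zero => exact ⟨1, fun x => by simp⟩
  | succ n ih =>
    obtain ⟨p, hp⟩ := ih
    refine ⟨p.derivative + p * (Polynomial.C α - Polynomial.C (k : ℂ) * Polynomial.X), fun x => ?_⟩
    rw [iteratedDeriv_succ, show iteratedDeriv n (cohFun k α) = _ from funext hp]
    have h := ((p.hasDerivAt (x : ℂ)).comp_ofReal).mul (hasDerivAt_cohFun k α x)
    refine h.deriv.trans ?_
    simp
    ring

theorem polynomial_mul_norm_cohFun_le {k : ℝ} (hk : 0 < k) (α : ℂ) (p : Polynomial ℂ) (j : ℕ) :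
    ∃ C, ∀ x : ℝ, |x| ^ j * ‖p.eval (x : ℂ) * cohFun k α x‖ ≤ C := by
  induction p using Polynomial.induction_on' with
  | add p q hp hq =>
    obtain ⟨C, hC⟩ := hp
    obtain ⟨D, hD⟩ := hq
    refine ⟨C + D, fun x => (le_trans ?_ (add_le_add (hC x) (hD x)))⟩
    rw [← mul_add, Polynomial.eval_add, add_mul]
    gcongr
    exact norm_add_le _ _
  | monomial n a =>
    obtain ⟨C, hC⟩ := pow_mul_norm_cohFun_le hk α (j + n)
    refine ⟨‖a‖ * C, fun x => ?_⟩
    refine le_trans (le_of_eq ?_) (mul_le_mul_of_nonneg_left (hC x) (norm_nonneg a))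
    simp
    ring

/-- The coherent state with parameter `α`, as a Schwartz function. -/
noncomputable def coh {k : ℝ} (hk : 0 < k) (α : ℂ) : 𝓢(ℝ, ℂ) where
  toFun := cohFun k α
  smooth' := contDiff_cohFun k α
  decay' j n := by
    obtain ⟨p, hp⟩ := iteratedDeriv_cohFun k α n
    obtain ⟨C, hC⟩ := polynomial_mul_norm_cohFun_le hk α p j
    exact ⟨C, fun x => by simpa [norm_iteratedFDeriv_eq_norm_iteratedDeriv, hp] using hC x⟩

theorem coh_apply {k : ℝ} (hk : 0 < k) (α : ℂ) (x : ℝ) : coh hk α x = cohFun k α x := rfl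

/-- The coherent state with parameter `α`, as an element of `L²(ℝ)`. -/
noncomputable def cohL {k : ℝ} (hk : 0 < k) (α : ℂ) : L2R := (coh hk α).toLp 2 volume

theorem inner_toLp (f g : 𝓢(ℝ, ℂ)) :
    inner ℂ (f.toLp 2 volume : L2R) (g.toLp 2 volume) = ∫ x, inner ℂ (f x) (g x) :=
  SchwartzMap.inner_toL2_toL2_eq f g

/-- A Gaussian integral in which the terms in `conj α ^ 2` and `β ^ 2` cancel. Rotating both
parameters by a common phase therefore changes nothing, which is why the evolution will be
isometric. -/
theorem inner_cohL {k : ℝ} (hk : 0 < k) (α β : ℂ) :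
    inner ℂ (cohL hk α) (cohL hk β) =
      (Real.pi / k : ℂ) ^ (1 / 2 : ℂ) * Complex.exp (conj α * β / (2 * k)) := by
  have hk' : (k : ℂ) ≠ 0 := by exact_mod_cast hk.ne'
  have h := integral_cexp_quadratic (b := -k) (by simpa using hk) (conj α + β)
    (-(conj α ^ 2 + β ^ 2) / (4 * k))
  rw [neg_neg] at h
  refine (inner_toLp (coh hk α) (coh hk β)).trans ?_
  have e : ∀ x : ℝ, inner ℂ (coh hk α x) (coh hk β x) = Complex.exp (-k * x ^ 2 +
      (conj α + β) * x + -(conj α ^ 2 + β ^ 2) / (4 * k)) := fun x => by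
    simp only [coh_apply, cohFun, RCLike.inner_apply, ← Complex.exp_conj, ← Complex.exp_add]
    congr 1
    simp only [map_sub, map_add, map_mul, map_neg, map_div₀, map_pow, map_ofNat,
      Complex.conj_ofReal]
    ring
  simp_rw [e, h]
  congr 2
  field_simp
  ring

/-- A square integrable function orthogonal to all coherent states vanishes. -/
theorem eq_zero_of_inner_cohL {k : ℝ} (hk : 0 < k) (Φ : L2R)
    (h : ∀ α, inner ℂ (cohL hk α) Φ = 0) : Φ = 0 := by
  have hG : Integrable (fun x => coh hk 0 x * Φ x) := by
    have := ((Lp.memLp Φ).mul (p := 2) (q := 2) (r := 1) ((coh hk 0).memLp 2))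
    exact memLp_one_iff_integrable.1 this
  have hF : ∀ ξ : ℝ, VectorFourier.fourierIntegral Real.fourierChar volume (innerₗ ℝ)
      (fun x => coh hk 0 x * Φ x) ξ = 0 := by
    intro ξ
    -- At an imaginary parameter the coherent state is a fixed Gaussian times a character, so
    -- orthogonality says that the Fourier transform of Gaussian times `Φ` vanishes.
    have h1 := h (2 * Real.pi * Complex.I * ξ)
    rw [L2.inner_def] at h1
    have e : (fun x => inner ℂ (cohL hk (2 * Real.pi * Complex.I * ξ) x) (Φ x)) =ᵐ[volume] fun x =>
        conj (Complex.exp (-(2 * Real.pi * Complex.I * ξ) ^ 2 / (4 * k))) *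
          (Real.fourierChar (-(innerₗ ℝ x ξ)) • (coh hk 0 x * Φ x)) := by
      filter_upwards [(coh hk (2 * Real.pi * Complex.I * ξ)).coeFn_toLp 2 volume] with x hx
      rw [cohL, hx, Circle.smul_def, Real.fourierChar_apply]
      simp only [coh_apply, cohFun, RCLike.inner_apply, ← Complex.exp_conj, smul_eq_mul]
      rw [mul_comm]
      simp only [← mul_assoc, ← Complex.exp_add]
      congr 2
      simp only [map_sub, map_add, map_mul, map_neg, map_div₀, map_pow, map_ofNat,
        Complex.conj_ofReal, Complex.conj_I]
      simp
      ring
    rw [integral_congr_ae e, integral_const_mul] at h1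
    exact (mul_eq_zero.1 h1).resolve_left (by simp [Complex.exp_ne_zero])
  have hz : ∀ᵐ x : ℝ, coh hk 0 x * Φ x = 0 := by
    -- Injectivity of the Fourier transform on `L¹`: a test function is the transform of some
    -- Schwartz `u`, and the transform is moved across the pairing.
    refine ae_eq_zero_of_integral_contDiff_smul_eq_zero hG.locallyIntegrable fun g hg hgs => ?_
    let g' : 𝓢(ℝ, ℂ) := HasCompactSupport.toSchwartzMap (f := fun x => (g x : ℂ))
      (hgs.comp_left (g := ((↑) : ℝ → ℂ)) rfl) (Complex.ofRealCLM.contDiff.comp hg)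
    obtain ⟨u, hu⟩ : ∃ u : 𝓢(ℝ, ℂ), FourierTransform.fourier u = g' :=
      ⟨FourierTransformInv.fourierInv g', by simp⟩
    have hsw := VectorFourier.integral_fourierIntegral_smul_eq_flip (L := innerₗ ℝ)
      Real.continuous_fourierChar (by exact continuous_inner) (μ := volume) (ν := volume)
      (f := u) (g := fun x => coh hk 0 x * Φ x) u.integrable hG
    have hflip : (innerₗ ℝ).flip = innerₗ ℝ := by ext; simp
    rw [hflip] at hsw
    simp only [hF, smul_zero, integral_zero] at hsw
    refine Eq.trans ?_ hsw
    refine integral_congr_ae (Eventually.of_forall fun x => ?_)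
    have : VectorFourier.fourierIntegral Real.fourierChar volume (innerₗ ℝ) u x = (g x : ℂ) := by
      change FourierTransform.fourier (u : ℝ → ℂ) x = _
      rw [← SchwartzMap.fourier_coe, hu]
      rfl
    simp only [this, Complex.real_smul, smul_eq_mul]
  rw [Lp.eq_zero_iff_ae_eq_zero]
  filter_upwards [hz] with x hx
  exact (mul_eq_zero.1 hx).resolve_left (by simp [coh_apply, cohFun, Complex.exp_ne_zero])

theorem dense_span_cohL {k : ℝ} (hk : 0 < k) :
    Dense (Submodule.span ℂ (range (cohL hk)) : Set L2R) := by
  rw [Submodule.dense_iff_topologicalClosure_eq_top, Submodule.topologicalClosure_eq_top_iff,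
    Submodule.eq_bot_iff]
  intro Φ hΦ
  refine eq_zero_of_inner_cohL hk Φ fun α => ?_
  exact hΦ _ (Submodule.subset_span ⟨α, rfl⟩)

/-! ### Differentiability of paths of Schwartz functions in `L²` -/

theorem toLp_add (f g : 𝓢(ℝ, ℂ)) :
    ((f + g).toLp 2 volume : L2R) = f.toLp 2 volume + g.toLp 2 volume :=
  map_add (SchwartzMap.toLpCLM ℂ ℂ 2 volume) f g

theorem toLp_sub (f g : 𝓢(ℝ, ℂ)) :
    ((f - g).toLp 2 volume : L2R) = f.toLp 2 volume - g.toLp 2 volume :=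
  map_sub (SchwartzMap.toLpCLM ℂ ℂ 2 volume) f g

theorem toLp_neg (f : 𝓢(ℝ, ℂ)) : ((-f).toLp 2 volume : L2R) = -f.toLp 2 volume :=
  map_neg (SchwartzMap.toLpCLM ℂ ℂ 2 volume) f

theorem toLp_smul (c : ℂ) (f : 𝓢(ℝ, ℂ)) :
    ((c • f).toLp 2 volume : L2R) = c • f.toLp 2 volume :=
  map_smul (SchwartzMap.toLpCLM ℂ ℂ 2 volume) c f

theorem toLp_real_smul (c : ℝ) (f : 𝓢(ℝ, ℂ)) :
    ((c • f).toLp 2 volume : L2R) = (c : ℂ) • f.toLp 2 volume := by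
  rw [← toLp_smul]
  congr 1


theorem norm_sq_toLp (f : 𝓢(ℝ, ℂ)) :
    ‖(f.toLp 2 volume : L2R)‖ ^ 2 = ∫ x, ‖f x‖ ^ 2 := by
  have h := inner_toLp f f
  rw [inner_self_eq_norm_sq_to_K] at h
  simp only [inner_self_eq_norm_sq_to_K] at h
  have h2 : ∫ x, ((RCLike.ofReal ‖f x‖ : ℂ)) ^ 2 = ((∫ x, ‖f x‖ ^ 2 : ℝ) : ℂ) := by
    rw [← integral_complex_ofReal]
    simp
  have h3 : ((‖(f.toLp 2 volume : L2R)‖ ^ 2 : ℝ) : ℂ) =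
      ((∫ x, ‖f x‖ ^ 2 : ℝ) : ℂ) := by
    rw [Complex.ofReal_pow]
    exact h.trans h2
  exact Complex.ofReal_injective h3

/-- A path of Schwartz functions with pointwise derivatives dominated in `L²` is differentiable
in `L²`. -/
theorem hasDerivAt_toLp {F F' : ℝ → 𝓢(ℝ, ℂ)} {t₀ : ℝ} {b : ℝ → ℝ} (hb : MemLp b 2 volume)
    (hF : ∀ x t, HasDerivAt (fun s => F s x) (F' t x) t)
    (hbound : ∀ t x, ‖F' t x‖ ≤ b x) :
    HasDerivAt (fun t => ((F t).toLp 2 volume : L2R)) ((F' t₀).toLp 2 volume) t₀ := by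
  rw [hasDerivAt_iff_tendsto_slope_zero, tendsto_iff_norm_sub_tendsto_zero]
  set D : ℝ → 𝓢(ℝ, ℂ) := fun t => ((t⁻¹ : ℝ) : ℂ) • (F (t₀ + t) - F t₀) - F' t₀ with hD
  have e : ∀ t : ℝ, ‖t⁻¹ • ((F (t₀ + t)).toLp 2 volume - (F t₀).toLp 2 volume : L2R) -
      (F' t₀).toLp 2 volume‖ = √(∫ x, ‖D t x‖ ^ 2) := fun t => by
    rw [← norm_sq_toLp, Real.sqrt_sq (norm_nonneg _)]
    simp only [hD, toLp_sub, toLp_smul]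
    rfl
  simp_rw [e]
  suffices h : Tendsto (fun t => ∫ x, ‖D t x‖ ^ 2) (𝓝[≠] 0) (𝓝 (∫ _ : ℝ, (0 : ℝ))) by
    simpa using h.sqrt
  have happ : ∀ t x, D t x = t⁻¹ • (F (t₀ + t) x - F t₀ x) - F' t₀ x := fun t x => by
    simp [hD]
  refine tendsto_integral_filter_of_dominated_convergence (fun x => (2 * b x) ^ 2)
    (Eventually.of_forall fun t => ?_) ?_ ?_ ?_
  · exact ((D t).continuous.norm.pow 2).aestronglyMeasurable
  · filter_upwards [self_mem_nhdsWithin] with t ht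
    refine Eventually.of_forall fun x => ?_
    rw [norm_pow, norm_norm]
    -- The mean value inequality bounds the difference quotient by `b x`; subtracting the derivative
    -- costs another `b x`, hence the dominating function `(2 * b x) ^ 2`.
    have h1 : ‖F (t₀ + t) x - F t₀ x‖ ≤ b x * ‖(t₀ + t) - t₀‖ :=
      convex_univ.norm_image_sub_le_of_norm_hasDerivWithin_le
        (fun s _ => (hF x s).hasDerivWithinAt) (fun s _ => hbound s x) (mem_univ _) (mem_univ _)
    rw [add_sub_cancel_left] at h1
    have h2 : ‖D t x‖ ≤ 2 * b x := by
      rw [happ]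
      refine (norm_sub_le _ _).trans ?_
      rw [norm_smul, norm_inv]
      have h3 : ‖t‖⁻¹ * ‖F (t₀ + t) x - F t₀ x‖ ≤ b x := by
        rw [inv_mul_le_iff₀ (norm_pos_iff.2 ht)]
        linarith
      linarith [hbound t₀ x]
    gcongr
  · simpa using! (hb.const_mul 2).integrable_sq
  · refine Eventually.of_forall fun x => ?_
    have h := (hF x t₀).tendsto_slope_zero
    have h2 := ((h.sub_const (F' t₀ x)).norm).pow 2
    simpa [happ] using h2

/-! ### The Hamiltonian on coherent states -/

theorem hamiltonian_smul (ħ m ω : ℝ) (c : ℂ) (φ : 𝓢(ℝ, ℂ)) :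
    hamiltonian ħ m ω (c • φ) = c • hamiltonian ħ m ω φ := by
  have h : (fun x : ℝ => x ^ 2).HasTemperateGrowth := by fun_prop
  have hX : SchwartzMap.smulLeftCLM ℂ (fun x : ℝ => x ^ 2) (c • φ) =
      c • SchwartzMap.smulLeftCLM ℂ (fun x : ℝ => x ^ 2) φ := by
    ext x
    simp only [SchwartzMap.smulLeftCLM_apply_apply h, smul_apply, smul_comm c]
  simp only [hamiltonian, map_smul, hX, smul_add, smul_neg, smul_comm c]

theorem iteratedDeriv_two_cohFun (k : ℝ) (α : ℂ) (x : ℝ) :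
    iteratedDeriv 2 (cohFun k α) x = ((α - k * x) ^ 2 - k) * cohFun k α x := by
  have hd : deriv (cohFun k α) = fun y : ℝ => (α - k * y) * cohFun k α y :=
    funext fun y => (hasDerivAt_cohFun k α y).deriv
  have hx : HasDerivAt (fun x : ℝ => (x : ℂ)) 1 x := Complex.ofRealCLM.hasDerivAt
  rw [iteratedDeriv_succ, iteratedDeriv_one, hd]
  refine ((((hx.const_mul (k : ℂ)).const_sub α).mul (hasDerivAt_cohFun k α x)).deriv).trans ?_
  ring

/-- For the width `k = m * ω / ħ` the quadratic terms of kinetic and potential energy cancel,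
leaving a factor affine in `x`. Such a factor can be matched by moving `α` and the phase. -/
theorem hamiltonian_coh {ħ m ω : ℝ} (hħ : 0 < ħ) (hm : 0 < m)
    (hk : 0 < m * ω / ħ) (α : ℂ) (x : ℝ) :
    hamiltonian ħ m ω (coh hk α) x =
      (ħ * ω * α * x - ħ ^ 2 * α ^ 2 / (2 * m) + ħ * ω / 2) * coh hk α x := by
  have e : iteratedDeriv 2 (coh hk α) x = _ := iteratedDeriv_two_cohFun (m * ω / ħ) α x
  have h1 : (ħ : ℂ) ≠ 0 := by exact_mod_cast hħ.ne'
  have h2 : (m : ℂ) ≠ 0 := by exact_mod_cast hm.ne'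
  rw [hamiltonian_apply, e, coh_apply]
  push_cast
  field_simp
  ring

theorem inner_deriv_deriv (φ ψ : 𝓢(ℝ, ℂ)) :
    inner ℂ ((SchwartzMap.derivCLM ℂ ℂ (SchwartzMap.derivCLM ℂ ℂ φ)).toLp 2 volume : L2R)
      (ψ.toLp 2 volume) =
    inner ℂ (φ.toLp 2 volume : L2R)
      ((SchwartzMap.derivCLM ℂ ℂ (SchwartzMap.derivCLM ℂ ℂ ψ)).toLp 2 volume) := by
  let B : ℂ →L[ℝ] ℂ →L[ℝ] ℂ :=
    (ContinuousLinearMap.mul ℝ ℂ).comp Complex.conjCLE.toContinuousLinearMap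
  have hB : ∀ a b : ℂ, inner ℂ a b = B a b := fun a b => by
    simp [B, RCLike.inner_apply, mul_comm]
  have key : ∀ f g : 𝓢(ℝ, ℂ), ∫ x, B (f x) (SchwartzMap.derivCLM ℂ ℂ g x) =
      -∫ x, B (SchwartzMap.derivCLM ℂ ℂ f x) (g x) := fun f g => by
    simpa using SchwartzMap.integral_bilinear_deriv_right_eq_neg_left f g B
  rw [inner_toLp, inner_toLp]
  simp only [hB]
  rw [key, key, neg_neg]

theorem inner_sq_mul (φ ψ : 𝓢(ℝ, ℂ)) :
    inner ℂ ((SchwartzMap.smulLeftCLM ℂ (fun x : ℝ => x ^ 2) φ).toLp 2 volume : L2R)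
      (ψ.toLp 2 volume) =
    inner ℂ (φ.toLp 2 volume : L2R)
      ((SchwartzMap.smulLeftCLM ℂ (fun x : ℝ => x ^ 2) ψ).toLp 2 volume) := by
  have h : (fun x : ℝ => x ^ 2).HasTemperateGrowth := by fun_prop
  rw [inner_toLp, inner_toLp]
  refine integral_congr_ae (Eventually.of_forall fun x => ?_)
  simp only [SchwartzMap.smulLeftCLM_apply_apply h, RCLike.inner_apply, Complex.real_smul, map_mul,
    Complex.conj_ofReal]
  ring

/-- The Hamiltonian is symmetric on Schwartz functions. -/
theorem inner_hamiltonian (ħ m ω : ℝ) (φ ψ : 𝓢(ℝ, ℂ)) :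
    inner ℂ ((hamiltonian ħ m ω φ).toLp 2 volume : L2R) (ψ.toLp 2 volume) =
      inner ℂ (φ.toLp 2 volume : L2R) ((hamiltonian ħ m ω ψ).toLp 2 volume) := by
  simp only [hamiltonian, toLp_add, toLp_neg, toLp_real_smul, inner_add_left, inner_add_right,
    inner_neg_left, inner_neg_right, inner_smul_left, inner_smul_right, inner_deriv_deriv,
    inner_sq_mul, Complex.conj_ofReal]

/-- The evolution of a coherent state under the Schrödinger equation. -/
noncomputable def cohPath {k : ℝ} (hk : 0 < k) (ω : ℝ) (α : ℂ) (t : ℝ) : 𝓢(ℝ, ℂ) :=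
  Complex.exp (-Complex.I * ω * t / 2) • coh hk (α * Complex.exp (-Complex.I * ω * t))

theorem cohPath_zero {k : ℝ} (hk : 0 < k) (ω : ℝ) (α : ℂ) : cohPath hk ω α 0 = coh hk α := by
  simp [cohPath]

theorem norm_exp_neg_I_mul (ω t : ℝ) : ‖Complex.exp (-Complex.I * ω * t)‖ = 1 := by
  rw [show -Complex.I * ω * t = ((-(ω * t) : ℝ) : ℂ) * Complex.I by push_cast; ring,
    Complex.norm_exp_ofReal_mul_I]

theorem norm_exp_neg_I_mul_half (ω t : ℝ) : ‖Complex.exp (-Complex.I * ω * t / 2)‖ = 1 := by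
  rw [show -Complex.I * ω * t / 2 = ((-(ω * t / 2) : ℝ) : ℂ) * Complex.I by push_cast; ring,
    Complex.norm_exp_ofReal_mul_I]

theorem hasDerivAt_cohFun_param (k x : ℝ) {A : ℝ → ℂ} {A' : ℂ} {t : ℝ} (hA : HasDerivAt A A' t) :
    HasDerivAt (fun s => cohFun k (A s) x)
      ((x - A t / (2 * k)) * A' * cohFun k (A t) x) t := by
  have h := (((hA.mul_const (x : ℂ)).const_add (-(k / 2 : ℂ) * x ^ 2)).fun_sub
    ((hA.fun_pow 2).div_const (4 * k : ℂ))).cexp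
  refine h.congr_deriv ?_
  rw [← cohFun]
  push_cast
  ring

theorem hasDerivAt_cohPath_apply {ħ m ω : ℝ} (hħ : 0 < ħ) (hm : 0 < m)
    (hk : 0 < m * ω / ħ) (α : ℂ) (x t : ℝ) :
    HasDerivAt (fun s => cohPath hk ω α s x)
      (((-(Complex.I / ħ)) • hamiltonian ħ m ω (cohPath hk ω α t)) x) t := by
  have h1 : (ħ : ℂ) ≠ 0 := by exact_mod_cast hħ.ne'
  have h2 : (m : ℂ) ≠ 0 := by exact_mod_cast hm.ne'
  have h3 : (ω : ℂ) ≠ 0 := by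
    rintro h
    have : ω = 0 := by exact_mod_cast h
    simp [this] at hk
  have ht : HasDerivAt (fun s : ℝ => (s : ℂ)) 1 t := Complex.ofRealCLM.hasDerivAt
  have hE : HasDerivAt (fun s : ℝ => Complex.exp (-Complex.I * ω * s)) _ t :=
    (ht.const_mul (-Complex.I * ω : ℂ)).cexp
  have hH : HasDerivAt (fun s : ℝ => Complex.exp (-Complex.I * ω * s / 2)) _ t :=
    ((ht.const_mul (-Complex.I * ω : ℂ)).div_const 2).cexp
  refine (hH.mul (hasDerivAt_cohFun_param (m * ω / ħ) x (hE.const_mul α))).congr_deriv ?_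
  simp only [cohPath, hamiltonian_smul, smul_apply, hamiltonian_coh hħ hm hk, smul_eq_mul,
    coh_apply]
  generalize Complex.exp (-Complex.I * ω * t / 2) = a
  generalize cohFun (m * ω / ħ) (α * Complex.exp (-Complex.I * ω * t)) x = b
  generalize Complex.exp (-Complex.I * ω * t) = e
  push_cast
  field_simp
  ring

/-- One `L²` majorant for all parameters in a disc, with the linear factor that the Hamiltonian
produces. Since `exp (B|x|) ≤ exp (Bx) + exp (-Bx)`, two coherent states with real parameters `±B`
suffice. -/
theorem exists_memLp_bound_cohFun {k : ℝ} (hk : 0 < k) (R C : ℝ) (hC : 0 ≤ C) :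
    ∃ b : ℝ → ℝ, MemLp b 2 volume ∧ ∀ A : ℂ, ‖A‖ ≤ R → ∀ x : ℝ,
      C * (1 + |x|) * ‖cohFun k A x‖ ≤ b x := by
  -- The extra `1` absorbs the factor `1 + |x| ≤ exp |x|`.
  set B : ℝ := R + 1 with hB
  refine ⟨fun x => C * Real.exp (R ^ 2 / (4 * k)) * Real.exp (B ^ 2 / (4 * k)) *
    (‖coh hk B x‖ + ‖coh hk (-B) x‖), ?_, fun A hA x => ?_⟩
  · exact (((coh hk B).memLp 2).norm.add ((coh hk (-B)).memLp 2).norm).const_mul _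
  have hn : ∀ b : ℝ, ‖coh hk b x‖ = Real.exp (-(b ^ 2 / (4 * k))) *
      Real.exp (-(k / 2) * x ^ 2 + b * x) := fun b => by
    rw [coh_apply, norm_cohFun, Complex.ofReal_re]
    congr 3
    rw [← Complex.ofReal_re (b ^ 2 / (4 * k))]
    push_cast
    rfl
  have hn2 := hn (-B)
  rw [neg_sq, Complex.ofReal_neg] at hn2
  have h1 : ‖cohFun k A x‖ ≤ Real.exp (R ^ 2 / (4 * k)) *
      Real.exp (-(k / 2) * x ^ 2 + R * |x|) := by
    rw [norm_cohFun]
    have hx : A.re * x ≤ R * |x| := (le_abs_self _).trans <| by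
      rw [abs_mul]
      gcongr
      exact (Complex.abs_re_le_norm A).trans hA
    refine mul_le_mul (Real.exp_le_exp.2 ?_) (Real.exp_le_exp.2 (by linarith)) (by positivity)
      (by positivity)
    refine (neg_le_abs _).trans ((Complex.abs_re_le_norm _).trans ?_)
    rw [norm_div, norm_pow, norm_mul, Complex.norm_real, Real.norm_of_nonneg hk.le]
    norm_num
    gcongr
  have h2 : 1 + |x| ≤ Real.exp |x| := by linarith [Real.add_one_le_exp |x|]
  have h3 : Real.exp (-(k / 2) * x ^ 2 + B * |x|) ≤
      Real.exp (-(k / 2) * x ^ 2 + B * x) + Real.exp (-(k / 2) * x ^ 2 + -B * x) := by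
    rcases abs_cases x with ⟨h, -⟩ | ⟨h, -⟩
    · rw [h]; linarith [Real.exp_pos (-(k / 2) * x ^ 2 + -B * x)]
    · rw [h, mul_neg, ← neg_mul]; linarith [Real.exp_pos (-(k / 2) * x ^ 2 + B * x)]
  calc C * (1 + |x|) * ‖cohFun k A x‖
      ≤ C * Real.exp |x| * (Real.exp (R ^ 2 / (4 * k)) *
        Real.exp (-(k / 2) * x ^ 2 + R * |x|)) := by gcongr
    _ = C * Real.exp (R ^ 2 / (4 * k)) * Real.exp (-(k / 2) * x ^ 2 + B * |x|) := by
      rw [show -(k / 2) * x ^ 2 + B * |x| = |x| + (-(k / 2) * x ^ 2 + R * |x|) by rw [hB]; ring,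
        Real.exp_add |x|]
      ring
    _ ≤ C * Real.exp (R ^ 2 / (4 * k)) *
        (Real.exp (-(k / 2) * x ^ 2 + B * x) + Real.exp (-(k / 2) * x ^ 2 + -B * x)) := by
      gcongr
    _ = _ := by
      beta_reduce
      rw [hn, hn2, ← mul_add, Real.exp_neg]
      field_simp

theorem hasDerivAt_cohPath {ħ m ω : ℝ} (hħ : 0 < ħ) (hm : 0 < m)
    (hk : 0 < m * ω / ħ) (α : ℂ) (t : ℝ) :
    HasDerivAt (fun s => ((cohPath hk ω α s).toLp 2 volume : L2R))
      ((-(Complex.I / ħ)) • ((hamiltonian ħ m ω (cohPath hk ω α t)).toLp 2 volume)) t := by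
  obtain ⟨b, hb, hbound⟩ := exists_memLp_bound_cohFun hk ‖α‖
    (|ħ|⁻¹ * (|ħ| * |ω| * ‖α‖ + |ħ| ^ 2 * ‖α‖ ^ 2 / (2 * |m|) + |ħ| * |ω| / 2)) (by positivity)
  rw [← toLp_smul]
  refine hasDerivAt_toLp (F' := fun t => (-(Complex.I / ħ)) • hamiltonian ħ m ω (cohPath hk ω α t))
    hb (fun x t => hasDerivAt_cohPath_apply hħ hm hk α x t) fun t x => ?_
  -- The parameter stays on the circle of radius `‖α‖`, so one majorant serves all times.
  have hA : ‖α * Complex.exp (-Complex.I * ω * t)‖ = ‖α‖ := by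
    rw [norm_mul, norm_exp_neg_I_mul, mul_one]
  refine le_trans ?_ (hbound _ hA.le x)
  simp only [cohPath, hamiltonian_smul, smul_apply, hamiltonian_coh hħ hm hk, smul_eq_mul,
    coh_apply]
  generalize α * Complex.exp (-Complex.I * ω * t) = A at hA
  have h1 : ‖(ħ * ω * A * x - ħ ^ 2 * A ^ 2 / (2 * m) + ħ * ω / 2 : ℂ)‖ ≤
      |ħ| * |ω| * ‖α‖ * |x| + |ħ| ^ 2 * ‖α‖ ^ 2 / (2 * |m|) + |ħ| * |ω| / 2 := by
    refine (norm_add_le _ _).trans (add_le_add ((norm_sub_le _ _).trans (le_of_eq ?_))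
      (le_of_eq ?_)) <;> simp [hA]
  have h2 : 0 ≤ (|ħ| * |ω| * ‖α‖) := by positivity
  have h3 : 0 ≤ (|ħ| ^ 2 * ‖α‖ ^ 2 / (2 * |m|) + |ħ| * |ω| / 2) * |x| := by positivity
  have h4 : ‖-(Complex.I / ħ)‖ = |ħ|⁻¹ := by simp
  rw [norm_mul, norm_mul, norm_mul, norm_exp_neg_I_mul_half, one_mul, h4, ← mul_assoc]
  refine mul_le_mul_of_nonneg_right ?_ (norm_nonneg (cohFun (m * ω / ħ) A x))
  rw [mul_assoc |ħ|⁻¹]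
  refine mul_le_mul_of_nonneg_left (h1.trans ?_) (by positivity)
  linarith

/-! ### Families of isometries determined on a total set -/

section Abstract

variable {H : Type*} [NormedAddCommGroup H] [InnerProductSpace ℂ H]

/-- Equal Gram matrices give equal norms of corresponding linear combinations, so `v i ↦ w i`
extends by density. -/
theorem exists_isometry_of_inner_eq [CompleteSpace H] {ι : Type*} (v w : ι → H)
    (hv : Dense (Submodule.span ℂ (range v) : Set H))
    (hw : Dense (Submodule.span ℂ (range w) : Set H))
    (h : ∀ i j, inner ℂ (v i) (v j) = inner ℂ (w i) (w j)) :
    ∃ T : H ≃ₗᵢ[ℂ] H, ∀ i, T (v i) = w i := by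
  have hd : ∀ u : ι → H, Dense (Submodule.span ℂ (range u) : Set H) →
      DenseRange (Finsupp.linearCombination ℂ u) := fun u hu => by
    rw [DenseRange, ← LinearMap.coe_range, Finsupp.range_linearCombination]
    exact hu
  have hn : ∀ x : ι →₀ ℂ, ‖Finsupp.linearCombination ℂ w (LinearEquiv.refl ℂ _ x)‖ =
      ‖Finsupp.linearCombination ℂ v x‖ := fun x => by
    have : inner ℂ (Finsupp.linearCombination ℂ w x) (Finsupp.linearCombination ℂ w x) =
        inner ℂ (Finsupp.linearCombination ℂ v x) (Finsupp.linearCombination ℂ v x) := by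
      simp only [Finsupp.linearCombination_apply, Finsupp.sum, sum_inner, inner_sum,
        inner_smul_left, inner_smul_right, h]
    rw [@norm_eq_sqrt_re_inner ℂ, @norm_eq_sqrt_re_inner ℂ, LinearEquiv.refl_apply, this]
  refine ⟨LinearEquiv.extendOfIsometry (LinearEquiv.refl ℂ (ι →₀ ℂ)) _ _ (hd v hv) (hd w hw) hn,
    fun i => ?_⟩
  have := LinearEquiv.extendOfIsometry_eq (LinearEquiv.refl ℂ (ι →₀ ℂ)) _ _ (hd v hv) (hd w hw) hn
    (Finsupp.single i 1)
  simpa using this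

/-- Strong continuity of a family of isometries need only be checked on a total set. -/
theorem continuous_apply_of_dense_span {X ι : Type*} [TopologicalSpace X]
    (T : X → (H →ₗᵢ[ℂ] H)) (v : ι → H) (hv : Dense (Submodule.span ℂ (range v) : Set H))
    (h : ∀ i, Continuous fun x => T x (v i)) (Ψ : H) : Continuous fun x => T x Ψ := by
  have hs : ∀ Φ ∈ Submodule.span ℂ (range v), Continuous fun x => T x Φ := by
    intro Φ hΦ
    induction hΦ using Submodule.span_induction with
    | mem y hy => obtain ⟨i, rfl⟩ := hy; exact h i
    | zero => simpa using continuous_const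
    | add y z _ _ hy hz => simp only [map_add]; exact hy.add hz
    | smul c y _ hy => simp only [map_smul]; exact hy.const_smul c
  refine continuous_of_uniform_approx_of_continuous fun u hu => ?_
  obtain ⟨ε, hε, hεu⟩ := Metric.mem_uniformity_dist.1 hu
  obtain ⟨Φ, hΦ, hd⟩ := hv.exists_dist_lt Ψ hε
  exact ⟨fun x => T x Φ, hs Φ hΦ, fun x => hεu (by rwa [(T x).isometry.dist_eq])⟩

theorem eq_of_dense_span {E ι : Type*} [NormedAddCommGroup E] [NormedSpace ℂ E]
    (S T : H →L[ℂ] E) (v : ι → H) (hv : Dense (Submodule.span ℂ (range v) : Set H))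
    (h : ∀ i, S (v i) = T (v i)) (Ψ : H) : S Ψ = T Ψ := by
  have : S = T := ContinuousLinearMap.ext_on hv (by rintro _ ⟨i, rfl⟩; exact h i)
  rw [this]

theorem eq_of_forall_inner {ι : Type*} (v : ι → H)
    (hv : Dense (Submodule.span ℂ (range v) : Set H)) {Φ Ψ : H}
    (h : ∀ i, inner ℂ (v i) Φ = inner ℂ (v i) Ψ) : Φ = Ψ := by
  refine ext_inner_right ℂ fun χ => ?_
  refine eq_of_dense_span (innerSL ℂ Φ) (innerSL ℂ Ψ) v hv (fun i => ?_) χ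
  simp only [innerSL_apply_apply]
  rw [← inner_conj_symm, h, inner_conj_symm]

/-- Applying strongly continuous isometries, starting at the identity, does not change the
derivative at zero of a path starting at zero. -/
theorem hasDerivAt_isometry_apply {A : ℝ → (H →ₗᵢ[ℂ] H)} {χ : ℝ → H} {χ' : H}
    (hA : Continuous fun t => A t χ') (hA0 : A 0 χ' = χ') (hχ0 : χ 0 = 0)
    (hχ : HasDerivAt χ χ' 0) : HasDerivAt (fun t => A t (χ t)) χ' 0 := by
  rw [hasDerivAt_iff_tendsto_slope_zero] at hχ ⊢
  simp only [zero_add, hχ0, map_zero, sub_zero] at hχ ⊢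
  have h1 : Tendsto (fun t => A t χ' - χ') (𝓝[≠] 0) (𝓝 0) := by
    have := (hA.tendsto 0).sub_const χ'
    rw [hA0, sub_self] at this
    exact this.mono_left nhdsWithin_le_nhds
  have h2 := tendsto_iff_norm_sub_tendsto_zero.1 hχ
  have h3 : Tendsto (fun t : ℝ => A t (t⁻¹ • χ t - χ')) (𝓝[≠] 0) (𝓝 0) := by
    rw [tendsto_zero_iff_norm_tendsto_zero]
    exact h2.congr fun t => ((A t).norm_map _).symm
  have h4 := (h3.add h1).add_const χ'
  simp only [map_sub, sub_add_sub_cancel, sub_add_cancel, add_zero, zero_add] at h4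
  refine h4.congr fun t => ?_
  exact (A t).toLinearMap.map_smul_of_tower t⁻¹ (χ t)

end Abstract

/-! ### The Schrödinger group -/

section Group

variable {ħ m ω : ℝ}

/-- `evolution` is picked by choice, so the formula has to hold for every Schrödinger group. The
explicit path `ψ` solves the equation, and `U (-s) (ψ s)` is shown to be constant. -/
theorem IsSchrodingerGroup.apply_cohL {U : ℝ → (L2R ≃ₗᵢ[ℂ] L2R)}
    (hU : IsSchrodingerGroup ħ m ω U) (hħ : 0 < ħ) (hm : 0 < m) (hk : 0 < m * ω / ħ)
    (α : ℂ) (t : ℝ) :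
    U t (cohL hk α) = ((cohPath hk ω α t).toLp 2 volume : L2R) := by
  set ψ : ℝ → L2R := fun s => (cohPath hk ω α s).toLp 2 volume with hψ
  set ψ' : ℝ → L2R := fun s =>
    (-(Complex.I / ħ)) • ((hamiltonian ħ m ω (cohPath hk ω α s)).toLp 2 volume) with hψ'
  have hd : ∀ s, HasDerivAt ψ (ψ' s) s := hasDerivAt_cohPath hħ hm hk α
  -- A product rule using the generator only at time zero and on Schwartz functions: factor out `U
  -- (-s)`, then split `U (-h) (ψ (s + h))` into `U (-h) (ψ s)` and `U (-h) (ψ (s + h) - ψ s)`,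
  -- whose derivatives cancel.
  have key : ∀ s, HasDerivAt (fun s => U (-s) (ψ s)) 0 s := by
    intro s
    have h1 : HasDerivAt (fun h => U (-h) (ψ s)) (-ψ' s) 0 := by
      have := (hU.hasDerivAt (cohPath hk ω α s))
      rw [← neg_zero] at this
      refine (this.scomp (0 : ℝ) (hasDerivAt_neg (0 : ℝ))).congr_deriv ?_
      rw [neg_one_smul]
    have h2 : HasDerivAt (fun h => U (-h) (ψ (s + h) - ψ s)) (ψ' s) 0 := by
      refine hasDerivAt_isometry_apply (A := fun h => (U (-h)).toLinearIsometry)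
        (χ := fun h => ψ (s + h) - ψ s) ?_ ?_ (by simp) ?_
      · exact (hU.continuous _).comp continuous_neg
      · simpa using hU.map_zero _
      · refine HasDerivAt.sub_const _ ?_
        refine HasDerivAt.comp_const_add s 0 ?_
        rw [add_zero]
        exact hd s
    have h3 : HasDerivAt (fun h => U (-h) (ψ (s + h))) 0 0 := by
      refine ((h1.add h2).congr_deriv (neg_add_cancel _)).congr_of_eventuallyEq
        (Eventually.of_forall fun h => ?_)
      simp
    have h4 := ((U (-s)).toContinuousLinearEquiv.toContinuousLinearMap.restrictScalars
      ℝ).hasFDerivAt.comp_hasDerivAt (0 : ℝ) h3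
    have h5 : HasDerivAt (fun h => U (-(s + h)) (ψ (s + h))) 0 0 := by
      refine (h4.congr_deriv (by simp)).congr_of_eventuallyEq (Eventually.of_forall fun h => ?_)
      simp only [neg_add, hU.map_add]
      rfl
    have h6 := HasDerivAt.comp_sub_const (f := fun h => U (-(s + h)) (ψ (s + h))) s s
      (by rw [sub_self]; exact h5)
    simpa using h6
  have hc := is_const_of_deriv_eq_zero (fun s => (key s).differentiableAt) (fun s => (key s).deriv)
    t 0
  simp only [neg_zero, hU.map_zero] at hc
  have h0 : ψ 0 = cohL hk α := by simp only [hψ, cohPath_zero, cohL]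
  rw [← h0, ← hc, ← hU.map_add, add_neg_cancel, hU.map_zero]

theorem toLp_cohPath {k : ℝ} (hk : 0 < k) (ω : ℝ) (α : ℂ) (t : ℝ) :
    ((cohPath hk ω α t).toLp 2 volume : L2R) = Complex.exp (-Complex.I * ω * t / 2) •
      cohL hk (α * Complex.exp (-Complex.I * ω * t)) := by
  rw [cohPath, toLp_smul, cohL]

theorem cohPath_add {k : ℝ} (hk : 0 < k) (ω : ℝ) (α : ℂ) (s t : ℝ) :
    cohPath hk ω α (s + t) = Complex.exp (-Complex.I * ω * t / 2) •
      cohPath hk ω (α * Complex.exp (-Complex.I * ω * t)) s := by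
  rw [cohPath, cohPath, smul_smul, ← Complex.exp_add, mul_assoc α, ← Complex.exp_add]
  congr 3 <;> push_cast <;> ring_nf

theorem inner_cohPath {k : ℝ} (hk : 0 < k) (ω : ℝ) (α β : ℂ) (t : ℝ) :
    inner ℂ ((cohPath hk ω α t).toLp 2 volume : L2R) ((cohPath hk ω β t).toLp 2 volume) =
      inner ℂ (cohL hk α) (cohL hk β) := by
  have h1 := Complex.conj_mul' (Complex.exp (-Complex.I * ω * t))
  have h2 := Complex.conj_mul' (Complex.exp (-Complex.I * ω * t / 2))
  rw [norm_exp_neg_I_mul] at h1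
  rw [norm_exp_neg_I_mul_half] at h2
  rw [toLp_cohPath, toLp_cohPath, inner_smul_left, inner_smul_right, inner_cohL, inner_cohL,
    ← mul_assoc, h2, map_mul, mul_mul_mul_comm, h1]
  simp

theorem dense_span_cohPath {k : ℝ} (hk : 0 < k) (ω t : ℝ) :
    Dense (Submodule.span ℂ (range fun α => ((cohPath hk ω α t).toLp 2 volume : L2R)) :
      Set L2R) := by
  refine (dense_span_cohL hk).mono (Submodule.span_le.2 ?_)
  rintro _ ⟨α, rfl⟩
  have h : cohL hk α = Complex.exp (Complex.I * ω * t / 2) •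
      ((cohPath hk ω (α * Complex.exp (Complex.I * ω * t)) t).toLp 2 volume : L2R) := by
    rw [toLp_cohPath, smul_smul, ← Complex.exp_add, mul_assoc α, ← Complex.exp_add]
    ring_nf
    simp
  rw [SetLike.mem_coe, h]
  exact Submodule.smul_mem _ _ (Submodule.subset_span ⟨_, rfl⟩)

/-- The quantum oscillator has a Schrödinger group. -/
theorem exists_isSchrodingerGroup (hħ : 0 < ħ) (hm : 0 < m) (hω : 0 < ω) :
    ∃ U, IsSchrodingerGroup ħ m ω U := by
  have hk : 0 < m * ω / ħ := by positivity
  have hv := dense_span_cohL hk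
  choose U hU using fun t => exists_isometry_of_inner_eq (cohL hk)
    (fun α => ((cohPath hk ω α t).toLp 2 volume : L2R)) hv (dense_span_cohPath hk ω t)
    (fun α β => (inner_cohPath hk ω α β t).symm)
  have hzero : ∀ Ψ, U 0 Ψ = Ψ := fun Ψ =>
    eq_of_dense_span (U 0).toContinuousLinearEquiv.toContinuousLinearMap
      (ContinuousLinearMap.id ℂ L2R) _ hv
      (fun α => (hU 0 α).trans (by rw [cohPath_zero]; rfl)) Ψ
  have hadd : ∀ (s t : ℝ) (Ψ : L2R), U (s + t) Ψ = U s (U t Ψ) := fun s t Ψ =>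
    eq_of_dense_span (U (s + t)).toContinuousLinearEquiv.toContinuousLinearMap
      ((U t).trans (U s)).toContinuousLinearEquiv.toContinuousLinearMap _ hv
      (fun α => by
        change U (s + t) (cohL hk α) = U s (U t (cohL hk α))
        rw [hU (s + t), hU t, cohPath_add, toLp_smul, toLp_cohPath hk ω α t, map_smul, hU s]) Ψ
  have hcont : ∀ Ψ, Continuous fun t => U t Ψ := fun Ψ =>
    continuous_apply_of_dense_span (fun t => (U t).toLinearIsometry) _ hv (fun α => by
      change Continuous fun t => U t (cohL hk α)
      simp only [hU]
      exact continuous_iff_continuousAt.2 fun t => (hasDerivAt_cohPath hħ hm hk α t).continuousAt) Ψ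
  have hinv : ∀ (t : ℝ) (Φ Ψ : L2R), inner ℂ Φ (U t Ψ) = inner ℂ (U (-t) Φ) Ψ := fun t Φ Ψ => by
    rw [← (U (-t)).inner_map_map Φ (U t Ψ), ← hadd, neg_add_cancel, hzero]
  refine ⟨U, hzero, hadd, hcont, fun φ => ?_⟩
  set G : L2R := (-(Complex.I / ħ)) • ((hamiltonian ħ m ω φ).toLp 2 volume) with hG
  set Φ : L2R := φ.toLp 2 volume with hΦ
  -- The integral form of the equation is tested against coherent states: there the adjoint `U (-s)`
  -- is explicit and differentiable, and symmetry of the Hamiltonian moves it onto `φ`. Strong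
  -- continuity then upgrades the weak identity to a norm derivative.
  have hint : ∀ t, U t Φ = Φ + ∫ s in (0 : ℝ)..t, U s G := by
    intro t
    refine eq_of_forall_inner _ hv fun α => ?_
    have hd : ∀ s ∈ uIcc 0 t, HasDerivAt (fun s => inner ℂ (cohL hk α) (U s Φ))
        (inner ℂ (cohL hk α) (U s G)) s := by
      intro s _
      have h1 := (hasDerivAt_cohPath hħ hm hk α (-s)).scomp s (hasDerivAt_neg s)
      have h2 := (h1.inner ℂ (hasDerivAt_const s Φ))
      simp only [inner_zero_right, zero_add] at h2
      refine (h2.congr_deriv ?_).congr_of_eventuallyEq (Eventually.of_forall fun r => ?_)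
      · rw [hinv, hU, hG, hΦ, inner_smul_right, ← inner_hamiltonian]
        simp only [neg_smul, one_smul, inner_neg_left, inner_smul_left]
        simp
        ring
      · simp only [hinv r, hU]
        rfl
    have h3 := intervalIntegral.integral_eq_sub_of_hasDerivAt hd
      ((continuous_const.inner (hcont G)).intervalIntegrable _ _)
    have h4 := (innerSL ℂ (cohL hk α)).intervalIntegral_comp_comm
      ((hcont G).intervalIntegrable (μ := volume) 0 t)
    simp only [innerSL_apply_apply] at h4
    rw [inner_add_right, ← h4, h3, hzero]
    ring
  have h6 : HasDerivAt (fun t => ∫ s in (0 : ℝ)..t, U s G) (U 0 G) 0 :=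
    ((hcont G).integral_hasStrictDerivAt 0 0).hasDerivAt
  rw [hzero] at h6
  exact (h6.const_add Φ).congr_of_eventuallyEq (Eventually.of_forall hint)

theorem isSchrodingerGroup_evolution (hħ : 0 < ħ) (hm : 0 < m) (hω : 0 < ω) :
    IsSchrodingerGroup ħ m ω (evolution ħ m ω) :=
  Classical.epsilon_spec (exists_isSchrodingerGroup hħ hm hω)

theorem evolution_cohL (hħ : 0 < ħ) (hm : 0 < m) (hω : 0 < ω) (hk : 0 < m * ω / ħ)
    (α : ℂ) (t : ℝ) :
    evolution ħ m ω t (cohL hk α) = Complex.exp (-Complex.I * ω * t / 2) •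
      cohL hk (α * Complex.exp (-Complex.I * ω * t)) := by
  rw [(isSchrodingerGroup_evolution hħ hm hω).apply_cohL hħ hm hk, toLp_cohPath]

end Group

/-! ### The oscillator flow -/

theorem oscFlow_add {m ω : ℝ} (h : m * ω ≠ 0) (s t : ℝ) (z : ℝ × ℝ) :
    oscFlow m ω (s + t) z = oscFlow m ω s (oscFlow m ω t z) := by
  have hm : m ≠ 0 := left_ne_zero_of_mul h
  have hω : ω ≠ 0 := right_ne_zero_of_mul h
  ext
  · simp only [oscFlow, mul_add, Real.cos_add, Real.sin_add]
    field_simp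
    ring
  · simp only [oscFlow, mul_add, Real.cos_add, Real.sin_add]
    field_simp
    ring

theorem oscFlow_neg_cancel {m ω : ℝ} (h : m * ω ≠ 0) (t : ℝ) (z : ℝ × ℝ) :
    oscFlow m ω t (oscFlow m ω (-t) z) = z := by
  rw [← oscFlow_add h, add_neg_cancel, oscFlow_zero]

theorem oscFlow_neg_cancel' {m ω : ℝ} (h : m * ω ≠ 0) (t : ℝ) (z : ℝ × ℝ) :
    oscFlow m ω (-t) (oscFlow m ω t z) = z := by
  rw [← oscFlow_add h, neg_add_cancel, oscFlow_zero]

/-- Once the product `m * ω` is fixed, mass and frequency enter only through the angle `ω * t`. -/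
theorem oscFlow_eq {m ω c : ℝ} (h : m * ω = c) (t : ℝ) (z : ℝ × ℝ) :
    oscFlow m ω t z = oscFlow c 1 (ω * t) z := by
  simp [oscFlow, h]

/-! ### The phase space parity operators -/

theorem norm_phase (ħ : ℝ) (p x u : ℝ) :
    ‖Complex.exp (2 * Complex.I * p * (u - x) / ħ)‖ = 1 := by
  rw [show 2 * Complex.I * p * (u - x) / ħ = ((2 * p * (u - x) / ħ : ℝ) : ℂ) * Complex.I by
    push_cast; ring, Complex.norm_exp_ofReal_mul_I]

theorem memLp_reflect (x : ℝ) (Ψ : L2R) : MemLp (fun u : ℝ => Ψ (2 * x - u)) 2 volume :=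
  (Lp.memLp Ψ).comp_measurePreserving (Measure.measurePreserving_sub_left volume (2 * x))

theorem eLpNorm_parity (ħ : ℝ) (z : ℝ × ℝ) (Ψ : L2R) :
    eLpNorm (fun u : ℝ => Complex.exp (2 * Complex.I * z.2 * (u - z.1) / ħ) * Ψ (2 * z.1 - u)) 2
      volume = eLpNorm Ψ 2 volume := by
  rw [← eLpNorm_comp_measurePreserving (Lp.aestronglyMeasurable Ψ)
    (Measure.measurePreserving_sub_left volume (2 * z.1))]
  refine eLpNorm_congr_norm_ae (Eventually.of_forall fun u => ?_)
  rw [norm_mul, norm_phase, one_mul]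
  rfl

theorem memLp_parity (ħ : ℝ) (z : ℝ × ℝ) (Ψ : L2R) :
    MemLp (fun u : ℝ => Complex.exp (2 * Complex.I * z.2 * (u - z.1) / ħ) * Ψ (2 * z.1 - u)) 2
      volume := by
  refine ⟨AEStronglyMeasurable.mul (Continuous.aestronglyMeasurable (by fun_prop))
    (memLp_reflect z.1 Ψ).1, ?_⟩
  rw [eLpNorm_parity]
  exact (Lp.memLp Ψ).2

/-- The unitary reflection of phase space at the point `z`. -/
noncomputable def parity (ħ : ℝ) (z : ℝ × ℝ) : L2R →ₗᵢ[ℂ] L2R where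
  toFun Ψ := (memLp_parity ħ z Ψ).toLp
  map_add' Φ Ψ := by
    rw [← MemLp.toLp_add]
    refine MemLp.toLp_congr _ _ ?_
    filter_upwards [(Measure.measurePreserving_sub_left volume (2 * z.1)).quasiMeasurePreserving.ae
      (Lp.coeFn_add Φ Ψ)] with u hu
    rw [Pi.add_apply, hu, Pi.add_apply, mul_add]
  map_smul' c Ψ := by
    rw [RingHom.id_apply, ← MemLp.toLp_const_smul]
    refine MemLp.toLp_congr _ _ ?_
    filter_upwards [(Measure.measurePreserving_sub_left volume (2 * z.1)).quasiMeasurePreserving.ae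
      (Lp.coeFn_smul c Ψ)] with u hu
    rw [Pi.smul_apply, hu, Pi.smul_apply, smul_eq_mul, smul_eq_mul, mul_left_comm]
  norm_map' Ψ := by
    simp only [LinearMap.coe_mk, AddHom.coe_mk]
    rw [Lp.norm_toLp, eLpNorm_parity, Lp.norm_def]

theorem coeFn_parity (ħ : ℝ) (z : ℝ × ℝ) (Ψ : L2R) :
    parity ħ z Ψ =ᵐ[volume]
      fun u : ℝ => Complex.exp (2 * Complex.I * z.2 * (u - z.1) / ħ) * Ψ (2 * z.1 - u) :=
  (memLp_parity ħ z Ψ).coeFn_toLp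

/-- Substituting `u = x + y` exhibits the Wigner function as the expectation of an isometry, whence
its uniform bound, its continuity and its covariance. -/
theorem wignerC_eq_inner (ħ : ℝ) (Ψ : L2R) (z : ℝ × ℝ) :
    wignerC ħ Ψ z = ((Real.pi * ħ)⁻¹ : ℝ) * inner ℂ Ψ (parity ħ z Ψ) := by
  rw [wignerC, L2.inner_def]
  congr 1
  have e : (fun u => inner ℂ (Ψ u) (parity ħ z Ψ u)) =ᵐ[volume] fun u : ℝ =>
      conj (Ψ u) * Ψ (2 * z.1 - u) * Complex.exp (2 * Complex.I * z.2 * (u - z.1) / ħ) := by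
    filter_upwards [coeFn_parity ħ z Ψ] with u hu
    rw [hu, RCLike.inner_apply]
    ring
  rw [integral_congr_ae e, ← integral_add_left_eq_self (fun u : ℝ => conj (Ψ u) *
    Ψ (2 * z.1 - u) * Complex.exp (2 * Complex.I * z.2 * (u - z.1) / ħ)) z.1]
  refine integral_congr_ae (Eventually.of_forall fun y => ?_)
  beta_reduce
  rw [show 2 * z.1 - (z.1 + y) = z.1 - y by ring]
  push_cast
  rw [add_sub_cancel_left]

theorem norm_wignerC_le {ħ : ℝ} (hħ : 0 < ħ) (Ψ : L2R) (z : ℝ × ℝ) :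
    ‖wignerC ħ Ψ z‖ ≤ (Real.pi * ħ)⁻¹ * ‖Ψ‖ ^ 2 := by
  rw [wignerC_eq_inner, norm_mul, Complex.norm_real, Real.norm_of_nonneg (by positivity)]
  gcongr
  refine (norm_inner_le_norm _ _).trans_eq ?_
  rw [LinearIsometry.norm_map, sq]

theorem abs_wigner_le {ħ : ℝ} (hħ : 0 < ħ) (Ψ : L2R) (z : ℝ × ℝ) :
    |wigner ħ Ψ z| ≤ (Real.pi * ħ)⁻¹ * ‖Ψ‖ ^ 2 :=
  (Complex.abs_re_le_norm _).trans (norm_wignerC_le hħ Ψ z)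

/-- The parameter of the coherent state centred at the phase space point `z`. -/
noncomputable def center (k ħ : ℝ) (z : ℝ × ℝ) : ℂ := k * z.1 + Complex.I * z.2 / ħ

/-- In the parameter plane the reflection is `α ↦ 2 * center - α`, up to a scalar. -/
theorem parity_cohL {k ħ : ℝ} (hk : 0 < k) (hħ : 0 < ħ) (z : ℝ × ℝ) (α : ℂ) :
    parity ħ z (cohL hk α) =
      Complex.exp ((α * conj (center k ħ z) - center k ħ z * conj (center k ħ z)) / k) •
        cohL hk (2 * center k ħ z - α) := by
  have h1 : (ħ : ℂ) ≠ 0 := by exact_mod_cast hħ.ne'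
  have h2 : (k : ℂ) ≠ 0 := by exact_mod_cast hk.ne'
  refine Lp.ext ?_
  filter_upwards [coeFn_parity ħ z (cohL hk α),
    Lp.coeFn_smul (Complex.exp ((α * conj (center k ħ z) - center k ħ z * conj (center k ħ z)) / k))
      (cohL hk (2 * center k ħ z - α)),
    (coh hk (2 * center k ħ z - α)).coeFn_toLp 2 volume,
    (Measure.measurePreserving_sub_left volume (2 * z.1)).quasiMeasurePreserving.ae
      ((coh hk α).coeFn_toLp 2 volume)] with u hu1 hu2 hu3 hu4
  rw [hu1, hu2, Pi.smul_apply, cohL, cohL, hu3, hu4, coh_apply, coh_apply, cohFun, cohFun,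
    smul_eq_mul, ← Complex.exp_add, ← Complex.exp_add]
  congr 1
  simp only [center, map_add, map_mul, map_div₀, Complex.conj_ofReal, Complex.conj_I]
  push_cast
  field_simp
  ring_nf

theorem continuous_parity {ħ : ℝ} (hħ : 0 < ħ) (Ψ : L2R) :
    Continuous fun z => parity ħ z Ψ := by
  -- The width `1` is arbitrary, since any total family decides strong continuity. Norm continuity
  -- in the parameter comes from expanding the squared distance with the explicit kernel.
  have hcoh : Continuous (cohL (one_pos : (0 : ℝ) < 1)) := by
    rw [continuous_iff_continuousAt]
    intro α
    rw [ContinuousAt, tendsto_iff_norm_sub_tendsto_zero]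
    have e : ∀ β : ℂ, ‖cohL (one_pos : (0 : ℝ) < 1) β - cohL one_pos α‖ =
        √((inner ℂ (cohL one_pos β) (cohL one_pos β) - inner ℂ (cohL one_pos β) (cohL one_pos α) -
          inner ℂ (cohL one_pos α) (cohL one_pos β) +
          inner ℂ (cohL one_pos α) (cohL one_pos α) : ℂ).re) := fun β => by
      rw [@norm_eq_sqrt_re_inner ℂ, inner_sub_sub_self]
      rfl
    simp only [e, inner_cohL]
    refine Continuous.tendsto' ?_ _ _ (by simp)
    fun_prop
  refine continuous_apply_of_dense_span (parity ħ) _ (dense_span_cohL one_pos) (fun α => ?_) Ψ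
  have hc : Continuous (center 1 ħ) := by
    unfold center
    fun_prop
  simp only [parity_cohL one_pos hħ]
  fun_prop

theorem continuous_wigner {ħ : ℝ} (hħ : 0 < ħ) (Ψ : L2R) : Continuous (wigner ħ Ψ) := by
  have h : wigner ħ Ψ = fun z => (((Real.pi * ħ)⁻¹ : ℝ) * inner ℂ Ψ (parity ħ z Ψ)).re :=
    funext fun z => by rw [wigner, wignerC_eq_inner]
  rw [h]
  exact Complex.continuous_re.comp
    (continuous_const.mul (continuous_const.inner (continuous_parity hħ Ψ)))

/-- In this complex coordinate the classical flow is the same rotation that the quantum evolution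
applies to coherent parameters. This coincidence is the source of `evolution_parity`. -/
theorem center_oscFlow {ħ m ω : ℝ} (hħ : 0 < ħ) (hm : 0 < m) (hω : 0 < ω) (t : ℝ) (z : ℝ × ℝ) :
    center (m * ω / ħ) ħ (oscFlow m ω t z) =
      center (m * ω / ħ) ħ z * Complex.exp (-Complex.I * ω * t) := by
  have h1 : (ħ : ℂ) ≠ 0 := by exact_mod_cast hħ.ne'
  have h2 : (m : ℂ) ≠ 0 := by exact_mod_cast hm.ne'
  have h3 : (ω : ℂ) ≠ 0 := by exact_mod_cast hω.ne'
  rw [show -Complex.I * ω * t = -(ω * t : ℂ) * Complex.I by ring, Complex.exp_mul_I,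
    Complex.cos_neg, Complex.sin_neg]
  simp only [center, oscFlow]
  push_cast
  field_simp
  ring_nf
  simp only [Complex.I_sq]
  ring_nf

/-- The quantum evolution intertwines the parity operators along the classical flow. -/
theorem evolution_parity {ħ m ω : ℝ} (hħ : 0 < ħ) (hm : 0 < m) (hω : 0 < ω) (t : ℝ)
    (z : ℝ × ℝ) (Ψ : L2R) :
    evolution ħ m ω t (parity ħ z Ψ) = parity ħ (oscFlow m ω t z) (evolution ħ m ω t Ψ) := by
  have hk : 0 < m * ω / ħ := by positivity
  refine eq_of_dense_span
    ((evolution ħ m ω t).toLinearIsometry.comp (parity ħ z)).toContinuousLinearMap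
    ((parity ħ (oscFlow m ω t z)).comp
      (evolution ħ m ω t).toLinearIsometry).toContinuousLinearMap _
    (dense_span_cohL hk) (fun α => ?_) Ψ
  change evolution ħ m ω t (parity ħ z (cohL hk α)) =
    parity ħ (oscFlow m ω t z) (evolution ħ m ω t (cohL hk α))
  -- The scalar in `parity_cohL` pairs a parameter with a conjugate, so a common rotation leaves it
  -- unchanged.
  have h1 := Complex.mul_conj' (Complex.exp (-Complex.I * ω * t))
  rw [norm_exp_neg_I_mul] at h1
  rw [parity_cohL hk hħ, map_smul, evolution_cohL hħ hm hω hk, evolution_cohL hħ hm hω hk,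
    map_smul, parity_cohL hk hħ, center_oscFlow hħ hm hω, smul_comm]
  congr 2
  · rw [map_mul, mul_mul_mul_comm α, mul_mul_mul_comm (center _ _ _), h1]
    simp
  · congr 1
    ring

/-- The Wigner function of the evolved state is transported by the classical flow. -/
theorem wigner_evolution {ħ m ω : ℝ} (hħ : 0 < ħ) (hm : 0 < m) (hω : 0 < ω) (t : ℝ)
    (z : ℝ × ℝ) (Ψ : L2R) :
    wigner ħ (evolution ħ m ω t Ψ) z = wigner ħ Ψ (oscFlow m ω (-t) z) := by
  have h := evolution_parity hħ hm hω t (oscFlow m ω (-t) z) Ψ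
  rw [oscFlow_neg_cancel (by positivity)] at h
  rw [wigner, wigner, wignerC_eq_inner, wignerC_eq_inner, ← h, LinearIsometryEquiv.inner_map_map]

/-! ### Parametric integrals of smooth functions -/

/-- An integral over a compact interval of a jointly smooth function is smooth in the parameter. -/
theorem contDiff_setIntegral_Ioc {E : Type} [NormedAddCommGroup E] [NormedSpace ℝ E]
    [ProperSpace E] (a b : ℝ) (n : ℕ) :
    ∀ {G : Type} [NormedAddCommGroup G] [NormedSpace ℝ G] {F : ℝ × E → G},
      ContDiff ℝ ((⊤ : ℕ∞) : WithTop ℕ∞) F →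
      ContDiff ℝ n (fun z => ∫ s in Ioc a b, F (s, z)) := by
  have hfin : ∀ {G : Type} [NormedAddCommGroup G] {f : ℝ → G}, Continuous f →
      Integrable f (volume.restrict (Ioc a b)) := fun {G} _ f hf =>
    (hf.integrableOn_Icc).mono_set Ioc_subset_Icc_self
  have key : ∀ {G : Type} [NormedAddCommGroup G] [NormedSpace ℝ G] {F : ℝ × E → G},
      ContDiff ℝ ((⊤ : ℕ∞) : WithTop ℕ∞) F → ∀ z, HasFDerivAt (fun z => ∫ s in Ioc a b, F (s, z))
        (∫ s in Ioc a b, (fderiv ℝ F (s, z)).comp (ContinuousLinearMap.inr ℝ ℝ E)) z := by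
    intro G _ _ F hF z
    have hF' : Continuous fun q : ℝ × E => (fderiv ℝ F q).comp (ContinuousLinearMap.inr ℝ ℝ E) :=
      (hF.continuous_fderiv (by simp)).clm_comp continuous_const
    obtain ⟨C, hC⟩ := (isCompact_Icc.prod (isCompact_closedBall z 1)).exists_bound_of_continuousOn
      (hF'.continuousOn (s := Icc a b ×ˢ Metric.closedBall z 1))
    refine hasFDerivAt_integral_of_dominated_of_fderiv_le (bound := fun _ => C)
      (F' := fun w s => (fderiv ℝ F (s, w)).comp (ContinuousLinearMap.inr ℝ ℝ E))
      (Metric.closedBall_mem_nhds z one_pos) (Eventually.of_forall fun w => ?_) ?_ ?_ ?_ ?_ ?_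
    · exact (hfin (hF.continuous.comp (by fun_prop))).1
    · exact hfin (hF.continuous.comp (by fun_prop))
    · exact (hfin (hF'.comp (f := fun s => (s, z)) (by fun_prop))).1
    · filter_upwards [ae_restrict_mem measurableSet_Ioc] with s hs w hw
      exact hC (s, w) ⟨Ioc_subset_Icc_self hs, hw⟩
    · exact hfin continuous_const
    · refine Eventually.of_forall fun s w _ => ?_
      exact ((hF.differentiable (by simp)) (s, w)).hasFDerivAt.comp w (hasFDerivAt_prodMk_right s w)
  -- The derivative is an integral of the same kind with values in linear maps, so the induction
  -- ranges over all target spaces `G`.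
  induction n with
  | zero =>
    intro G _ _ F hF
    exact contDiff_zero.2 (continuous_iff_continuousAt.2 fun z => (key hF z).continuousAt)
  | succ n ih =>
    intro G _ _ F hF
    push_cast
    exact contDiff_succ_iff_hasFDerivAt.2 ⟨_, ih ((hF.fderiv_right (by simp)).clm_comp
      contDiff_const), key hF⟩

/-! ### Averages over the classical flow -/

section Average

variable {c : ℝ}

theorem contDiff_oscFlow (c : ℝ) {n : WithTop ℕ∞} :
    ContDiff ℝ n fun q : ℝ × (ℝ × ℝ) => oscFlow c 1 q.1 q.2 := by
  unfold oscFlow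
  fun_prop

theorem continuous_oscFlow (c s : ℝ) : Continuous (oscFlow c 1 s) := by
  unfold oscFlow
  fun_prop

theorem oscFlow_periodic (c : ℝ) (z : ℝ × ℝ) :
    Function.Periodic (fun s => oscFlow c 1 s z) (2 * Real.pi) := fun s => by
  simp [oscFlow]

/-- The flow as a measurable equivalence. -/
noncomputable def oscFlowEquiv (hc : 0 < c) (s : ℝ) : (ℝ × ℝ) ≃ᵐ (ℝ × ℝ) where
  toFun := oscFlow c 1 s
  invFun := oscFlow c 1 (-s)
  left_inv := oscFlow_neg_cancel' (by simpa using hc.ne') s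
  right_inv := oscFlow_neg_cancel (by simpa using hc.ne') s
  measurable_toFun := (continuous_oscFlow c s).measurable
  measurable_invFun := (continuous_oscFlow c (-s)).measurable

/-- Liouville's theorem for the oscillator. -/
theorem measurePreserving_oscFlow (hc : 0 < c) (s : ℝ) :
    MeasurePreserving (oscFlow c 1 s) volume volume := by
  refine ⟨(oscFlowEquiv hc s).measurable, ?_⟩
  set A : Matrix (Fin 2) (Fin 2) ℝ := !![Real.cos s, Real.sin s / c; -(c * Real.sin s), Real.cos s]
    with hA
  have hdet : LinearMap.det (Matrix.toLin (Module.Basis.finTwoProd ℝ)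
      (Module.Basis.finTwoProd ℝ) A) = 1 := by
    rw [LinearMap.det_toLin, hA, Matrix.det_fin_two_of]
    field_simp
    linarith [Real.sin_sq_add_cos_sq s]
  have h := Measure.map_linearMap_addHaar_eq_smul_addHaar (volume : Measure (ℝ × ℝ))
    (f := Matrix.toLin (Module.Basis.finTwoProd ℝ) (Module.Basis.finTwoProd ℝ) A)
    (by rw [hdet]; exact one_ne_zero)
  rw [hdet] at h
  have e : (Matrix.toLin (Module.Basis.finTwoProd ℝ) (Module.Basis.finTwoProd ℝ) A :
      ℝ × ℝ → ℝ × ℝ) = oscFlow c 1 s := by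
    funext z
    rw [hA, Matrix.toLin_finTwoProd_apply]
    simp only [oscFlow, one_mul, mul_one]
    ext <;> ring
  rw [e] at h
  simpa using h

/-- The sublevel sets of the oscillator energy. -/
def energyBall (c R : ℝ) : Set (ℝ × ℝ) := {z | (c * z.1) ^ 2 + z.2 ^ 2 ≤ R}

/-- Conservation of energy. These compact invariant sets let locally integrable functions be cut off
without disturbing the flow. -/
theorem oscFlow_mem_energyBall (hc : 0 < c) (R s : ℝ) (z : ℝ × ℝ) :
    oscFlow c 1 s z ∈ energyBall c R ↔ z ∈ energyBall c R := by
  have : (c * (oscFlow c 1 s z).1) ^ 2 + (oscFlow c 1 s z).2 ^ 2 = (c * z.1) ^ 2 + z.2 ^ 2 := by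
    simp only [oscFlow, one_mul, mul_one]
    have h1 : c * (z.1 * Real.cos s + z.2 / c * Real.sin s) =
        c * z.1 * Real.cos s + z.2 * Real.sin s := by field_simp
    rw [h1]
    linear_combination ((c * z.1) ^ 2 + z.2 ^ 2) * Real.sin_sq_add_cos_sq s
  simp only [energyBall, mem_ofPred_eq, this]

theorem isCompact_energyBall (hc : 0 < c) (R : ℝ) : IsCompact (energyBall c R) := by
  refine Metric.isCompact_of_isClosed_isBounded (isClosed_le (by fun_prop) continuous_const) ?_
  refine ((Metric.isBounded_Icc (-(√R / c)) (√R / c)).prod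
    (Metric.isBounded_Icc (-√R) (√R))).subset fun z hz => ?_
  have hz' : (c * z.1) ^ 2 + z.2 ^ 2 ≤ R := hz
  have h1 := Real.abs_le_sqrt (x := c * z.1) (y := R) (by nlinarith [sq_nonneg z.2])
  have h2 := Real.abs_le_sqrt (x := z.2) (y := R) (by nlinarith [sq_nonneg (c * z.1)])
  rw [abs_mul, abs_of_pos hc, mul_comm, ← le_div_iff₀ hc] at h1
  exact ⟨abs_le.1 h1, abs_le.1 h2⟩

theorem exists_subset_energyBall (c : ℝ) {K : Set (ℝ × ℝ)} (hK : IsCompact K) :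
    ∃ R, K ⊆ energyBall c R := by
  obtain ⟨R, hR⟩ := hK.exists_bound_of_continuousOn
    (f := fun z : ℝ × ℝ => (c * z.1) ^ 2 + z.2 ^ 2) (by fun_prop)
  exact ⟨R, fun z hz => (le_abs_self _).trans (hR z hz)⟩

/-- The skew product form supplies the joint measurability and integrability that Fubini requires
for an `F` that is only integrable. -/
theorem measurePreserving_oscFlow_prod (hc : 0 < c) {θ : ℝ → ℝ} (hθ : Continuous θ)
    (ν : Measure ℝ) [SFinite ν] :
    MeasurePreserving (fun q : ℝ × (ℝ × ℝ) => (q.1, oscFlow c 1 (θ q.1) q.2))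
      (ν.prod volume) (ν.prod volume) :=
  (MeasurePreserving.id ν).skew_product
    (g := fun s z => oscFlow c 1 (θ s) z)
    ((contDiff_oscFlow c (n := 0)).continuous.comp
      ((hθ.comp continuous_fst).prodMk continuous_snd)).measurable
    (Eventually.of_forall fun s => (measurePreserving_oscFlow hc (θ s)).map_eq)

theorem integrable_comp_oscFlow (hc : 0 < c) {θ : ℝ → ℝ} (hθ : Continuous θ) (ν : Measure ℝ)
    [IsFiniteMeasure ν] {F : ℝ × ℝ → ℝ} (hF : Integrable F volume) :
    Integrable (fun q : ℝ × (ℝ × ℝ) => F (oscFlow c 1 (θ q.1) q.2)) (ν.prod volume) :=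
  (measurePreserving_oscFlow_prod hc hθ ν).integrable_comp_of_integrable
    (g := fun q : ℝ × (ℝ × ℝ) => F q.2) (hF.comp_snd ν)

theorem orbitAverage_eq (c : ℝ) (F : ℝ × ℝ → ℝ) (z : ℝ × ℝ) :
    orbitAverage c F z =
      (2 * Real.pi)⁻¹ * ∫ s in Ioc 0 (2 * Real.pi), F (oscFlow c 1 s z) := by
  rw [orbitAverage, intervalIntegral.integral_of_le (by positivity)]

/-- By periodicity the average ignores the direction of time; both the adjoint and the Wigner
transport involve the reversed flow. -/
theorem orbitAverage_eq_neg (c : ℝ) (F : ℝ × ℝ → ℝ) (z : ℝ × ℝ) :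
    orbitAverage c F z =
      (2 * Real.pi)⁻¹ * ∫ s in (0 : ℝ)..2 * Real.pi, F (oscFlow c 1 (-s) z) := by
  have hp : Function.Periodic (fun s => F (oscFlow c 1 s z)) (2 * Real.pi) := fun s =>
    congrArg F (oscFlow_periodic c z s)
  rw [orbitAverage, intervalIntegral.integral_comp_neg (fun s => F (oscFlow c 1 s z)), neg_zero]
  have := hp.intervalIntegral_add_eq (-(2 * Real.pi)) 0
  rw [neg_add_cancel, zero_add] at this
  rw [this]

theorem locallyIntegrable_orbitAverage (hc : 0 < c) {F : ℝ × ℝ → ℝ} (hF : LocallyIntegrable F) :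
    LocallyIntegrable (orbitAverage c F) := by
  rw [locallyIntegrable_iff]
  intro K hK
  obtain ⟨R, hR⟩ := exists_subset_energyBall c hK
  have hm : MeasurableSet (energyBall c R) := (isCompact_energyBall hc R).measurableSet
  refine IntegrableOn.mono_set ?_ hR
  have h1 : Integrable ((energyBall c R).indicator F) volume :=
    (integrable_indicator_iff hm).2 (hF.integrableOn_isCompact (isCompact_energyBall hc R))
  have h2 := (integrable_comp_oscFlow hc continuous_id
    (volume.restrict (Ioc 0 (2 * Real.pi))) h1).integral_prod_right
  refine ((h2.const_mul (2 * Real.pi)⁻¹).integrableOn (s := energyBall c R)).congr_fun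
    (fun z hz => ?_) hm
  simp only [orbitAverage_eq, id]
  congr 1
  refine integral_congr_ae (Eventually.of_forall fun s => ?_)
  exact indicator_of_mem ((oscFlow_mem_energyBall hc R s z).2 hz) F

theorem integrable_mul_comp_oscFlow (hc : 0 < c) (ν : Measure ℝ) [IsFiniteMeasure ν]
    {f F : ℝ × ℝ → ℝ} (hf : Continuous f) (hfs : HasCompactSupport f) (hF : LocallyIntegrable F) :
    Integrable (fun q : ℝ × (ℝ × ℝ) => f q.2 * F (oscFlow c 1 q.1 q.2)) (ν.prod volume) := by
  obtain ⟨R, hR⟩ := exists_subset_energyBall c hfs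
  obtain ⟨C, hC⟩ := hfs.exists_bound_of_continuous hf
  have hm : MeasurableSet (energyBall c R) := (isCompact_energyBall hc R).measurableSet
  have h1 : Integrable ((energyBall c R).indicator F) volume :=
    (integrable_indicator_iff hm).2 (hF.integrableOn_isCompact (isCompact_energyBall hc R))
  have h2 := (integrable_comp_oscFlow hc continuous_id ν h1).bdd_mul
    (f := fun q : ℝ × (ℝ × ℝ) => f q.2) (c := C)
    (hf.comp continuous_snd).aestronglyMeasurable (Eventually.of_forall fun q => hC q.2)
  refine h2.congr (Eventually.of_forall fun q => ?_)
  by_cases hq : f q.2 = 0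
  · simp [hq]
  · beta_reduce
    rw [id, indicator_of_mem]
    exact (oscFlow_mem_energyBall hc R q.1 q.2).2 (hR (subset_tsupport _ hq))

/-- Averaging over the flow is self-adjoint. -/
theorem integral_mul_orbitAverage (hc : 0 < c) {f F : ℝ × ℝ → ℝ} (hf : Continuous f)
    (hfs : HasCompactSupport f) (hF : LocallyIntegrable F) :
    ∫ z, f z * orbitAverage c F z = ∫ z, orbitAverage c f z * F z := by
  set ν : Measure ℝ := volume.restrict (Ioc 0 (2 * Real.pi)) with hν
  have h1 := integrable_mul_comp_oscFlow hc ν hf hfs hF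
  have hinv : ∀ s z, oscFlow c 1 s (oscFlow c 1 (-s) z) = z :=
    oscFlow_neg_cancel (by simpa using hc.ne')
  have h2 : Integrable (fun q : ℝ × (ℝ × ℝ) => f (oscFlow c 1 (-q.1) q.2) * F q.2)
      (ν.prod volume) := by
    have := (measurePreserving_oscFlow_prod hc continuous_neg ν).integrable_comp_of_integrable h1
    refine this.congr (Eventually.of_forall fun q => ?_)
    simp only [Function.comp, hinv]
  have h3 : ∀ z, orbitAverage c f z =
      (2 * Real.pi)⁻¹ * ∫ s in Ioc 0 (2 * Real.pi), f (oscFlow c 1 (-s) z) := fun z => by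
    rw [orbitAverage_eq_neg, intervalIntegral.integral_of_le (by positivity)]
  calc ∫ z, f z * orbitAverage c F z
      = ∫ z, (2 * Real.pi)⁻¹ * ∫ s, f z * F (oscFlow c 1 s z) ∂ν := by
        refine integral_congr_ae (Eventually.of_forall fun z => ?_)
        simp only [orbitAverage_eq, integral_const_mul]
        ring
    _ = (2 * Real.pi)⁻¹ * ∫ s, (∫ z, f z * F (oscFlow c 1 s z)) ∂ν := by
        rw [integral_const_mul]
        congr 1
        exact integral_integral_swap (f := fun z s => f z * F (oscFlow c 1 s z)) h1.swap
    _ = (2 * Real.pi)⁻¹ * ∫ s, (∫ z, f (oscFlow c 1 (-s) z) * F z) ∂ν := by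
        -- Liouville: the substitution by the reversed flow moves it from `F` to `f`.
        congr 2
        funext s
        rw [← (measurePreserving_oscFlow hc (-s)).integral_comp
          (oscFlowEquiv hc (-s)).measurableEmbedding]
        simp only [hinv]
    _ = ∫ z, (2 * Real.pi)⁻¹ * ∫ s, f (oscFlow c 1 (-s) z) * F z ∂ν := by
        rw [integral_const_mul]
        congr 1
        exact (integral_integral_swap (f := fun z s => f (oscFlow c 1 (-s) z) * F z) h2.swap).symm
    _ = ∫ z, orbitAverage c f z * F z := by
        refine integral_congr_ae (Eventually.of_forall fun z => ?_)
        simp only [h3, integral_mul_const]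
        ring

/-- Compact support survives because energy balls are invariant; smoothness is differentiation under
the integral. -/
theorem IsTest.orbitAverage (hc : 0 < c) {f : ℝ × ℝ → ℝ} (hf : IsTest f) :
    IsTest (orbitAverage c f) := by
  refine ⟨?_, ?_⟩
  · rw [funext (orbitAverage_eq c f)]
    refine contDiff_const.mul (contDiff_infty.2 fun n => ?_)
    exact contDiff_setIntegral_Ioc 0 (2 * Real.pi) n
      (F := fun q : ℝ × (ℝ × ℝ) => f (oscFlow c 1 q.1 q.2)) (hf.1.comp (contDiff_oscFlow c))
  · obtain ⟨R, hR⟩ := exists_subset_energyBall c hf.2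
    refine HasCompactSupport.intro (isCompact_energyBall hc R) fun z hz => ?_
    rw [orbitAverage_eq]
    have : ∀ s, f (oscFlow c 1 s z) = 0 := fun s => by
      by_contra h
      exact hz ((oscFlow_mem_energyBall hc R s z).1 (hR (subset_tsupport _ h)))
    simp [this]

theorem continuous_orbitAverage (c : ℝ) {F : ℝ × ℝ → ℝ} (hF : Continuous F) :
    Continuous (orbitAverage c F) := by
  unfold QHO.orbitAverage
  exact continuous_const.mul (intervalIntegral.continuous_parametric_intervalIntegral_of_continuous'
    (f := fun z s => F (oscFlow c 1 s z)) (hF.comp ((contDiff_oscFlow c (n := 0)).continuous.comp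
      (continuous_snd.prodMk continuous_fst))) _ _)

end Average

/-! ### Equidistribution of randomly rescaled angles -/

section Equidistribution

variable {ν : Measure ℝ} [IsProbabilityMeasure ν]

/-- The Riemann–Lebesgue lemma for the density of `ν`; the factor `-(2π)⁻¹` converts to the
normalization of the Fourier character. -/
theorem tendsto_integral_exp_of_absolutelyContinuous (hν : ν ≪ volume) :
    Tendsto (fun w : ℝ => ∫ x, Complex.exp (Complex.I * w * x) ∂ν) (cocompact ℝ) (𝓝 0) := by
  have h := Real.tendsto_integral_exp_smul_cocompact fun x => ((ν.rnDeriv volume x).toReal : ℂ)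
  have hmap : Tendsto (fun w : ℝ => -(2 * Real.pi)⁻¹ * w) (cocompact ℝ) (cocompact ℝ) :=
    (Homeomorph.mulLeft₀ (-(2 * Real.pi)⁻¹) (by simp [Real.pi_ne_zero])).isClosedEmbedding
      |>.tendsto_cocompact
  refine (h.comp hmap).congr fun w => ?_
  rw [← integral_rnDeriv_smul hν]
  refine integral_congr_ae (Eventually.of_forall fun x => ?_)
  have hpi : (Real.pi : ℂ) ≠ 0 := by exact_mod_cast Real.pi_ne_zero
  simp only [Circle.smul_def, Real.fourierChar_apply, smul_eq_mul, Complex.real_smul]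
  rw [mul_comm]
  congr 2
  push_cast
  field_simp

/-- Weyl's argument: the zero mode is exact, every other mode tends to zero by Riemann–Lebesgue, and
trigonometric polynomials are uniformly dense, with an error independent of `t`. -/
theorem tendsto_integral_circle (hν : ν ≪ volume) [Fact (0 < 2 * Real.pi)]
    (h : C(AddCircle (2 * Real.pi), ℂ)) :
    Tendsto (fun t : ℝ => ∫ x, h ((x * t : ℝ) : AddCircle (2 * Real.pi)) ∂ν) atTop
      (𝓝 ((2 * Real.pi : ℂ)⁻¹ * ∫ s in (0 : ℝ)..2 * Real.pi,
        h (s : AddCircle (2 * Real.pi)))) := by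
  have hpi : (Real.pi : ℂ) ≠ 0 := by exact_mod_cast Real.pi_ne_zero
  have hmk : Continuous ((↑) : ℝ → AddCircle (2 * Real.pi)) := AddCircle.continuous_mk' _
  have hint : ∀ (h : C(AddCircle (2 * Real.pi), ℂ)) (t : ℝ),
      Integrable (fun x : ℝ => h ((x * t : ℝ) : AddCircle (2 * Real.pi))) ν := fun h t =>
    Integrable.of_bound (h.continuous.comp (hmk.comp (by fun_prop))).aestronglyMeasurable ‖h‖
      (Eventually.of_forall fun x => h.norm_coe_le_norm _)
  have hint' : ∀ (h : C(AddCircle (2 * Real.pi), ℂ)),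
      IntervalIntegrable (fun s : ℝ => h (s : AddCircle (2 * Real.pi))) volume 0 (2 * Real.pi) :=
    fun h => (h.continuous.comp hmk).intervalIntegrable _ _
  have hspan : ∀ g ∈ Submodule.span ℂ (range (@fourier (2 * Real.pi))),
      Tendsto (fun t : ℝ => ∫ x, g ((x * t : ℝ) : AddCircle (2 * Real.pi)) ∂ν) atTop
        (𝓝 ((2 * Real.pi : ℂ)⁻¹ * ∫ s in (0 : ℝ)..2 * Real.pi,
          g (s : AddCircle (2 * Real.pi)))) := by
    intro g hg
    induction hg using Submodule.span_induction with
    | mem y hy =>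
      obtain ⟨n, rfl⟩ := hy
      have e : ∀ x : ℝ, fourier n (x : AddCircle (2 * Real.pi)) =
          Complex.exp (Complex.I * n * x) := fun x => by
        rw [fourier_coe_apply]
        congr 1
        push_cast
        field_simp
      simp only [e]
      rcases eq_or_ne n 0 with rfl | hn
      · simp
        field_simp
      · have h1 : ∫ s in (0 : ℝ)..2 * Real.pi, Complex.exp (Complex.I * n * s) = 0 := by
          rw [integral_exp_mul_complex (by simp [hn])]
          have : Complex.exp (Complex.I * n * (2 * Real.pi : ℝ)) = 1 :=
            Complex.exp_eq_one_iff.2 ⟨n, by push_cast; ring⟩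
          rw [this]
          simp
        rw [h1, mul_zero]
        have hmap : Tendsto (fun t : ℝ => (n : ℝ) * t) atTop (cocompact ℝ) :=
          (Homeomorph.mulLeft₀ (n : ℝ) (by exact_mod_cast hn)).isClosedEmbedding
            |>.tendsto_cocompact.comp
            atTop_le_cocompact
        refine ((tendsto_integral_exp_of_absolutelyContinuous hν).comp hmap).congr fun t => ?_
        refine integral_congr_ae (Eventually.of_forall fun x => ?_)
        beta_reduce
        push_cast
        ring_nf
    | zero => simp
    | add y z _ _ hy hz =>
      have := hy.add hz
      simp only [ContinuousMap.add_apply]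
      rw [intervalIntegral.integral_add (hint' y) (hint' z), mul_add]
      refine this.congr fun t => ?_
      rw [integral_add (hint y t) (hint z t)]
    | smul a y _ hy =>
      have := hy.const_mul a
      simp only [ContinuousMap.smul_apply, smul_eq_mul, integral_const_mul,
        intervalIntegral.integral_const_mul]
      rwa [mul_left_comm]
  have hdense : h ∈ closure (Submodule.span ℂ (range (@fourier (2 * Real.pi))) : Set _) := by
    rw [← Submodule.topologicalClosure_coe, span_fourier_closure_eq_top]
    trivial
  rw [Metric.tendsto_nhds]
  intro ε hε
  obtain ⟨g, hg, hgd⟩ := Metric.mem_closure_iff.1 hdense (ε / 3) (by positivity)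
  rw [dist_eq_norm] at hgd
  have hb1 : ∀ t : ℝ, dist (∫ x, h ((x * t : ℝ) : AddCircle (2 * Real.pi)) ∂ν)
      (∫ x, g ((x * t : ℝ) : AddCircle (2 * Real.pi)) ∂ν) ≤ ‖h - g‖ := fun t => by
    rw [dist_eq_norm, ← integral_sub (hint h t) (hint g t)]
    refine (norm_integral_le_of_norm_le_const (C := ‖h - g‖)
      (Eventually.of_forall fun x => (h - g).norm_coe_le_norm _)).trans ?_
    simp
  have hb2 : dist ((2 * Real.pi : ℂ)⁻¹ * ∫ s in (0 : ℝ)..2 * Real.pi,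
        g (s : AddCircle (2 * Real.pi))) ((2 * Real.pi : ℂ)⁻¹ * ∫ s in (0 : ℝ)..2 * Real.pi,
        h (s : AddCircle (2 * Real.pi))) ≤ ‖h - g‖ := by
    rw [dist_comm, dist_eq_norm, ← mul_sub, ← intervalIntegral.integral_sub (hint' h) (hint' g),
      norm_mul]
    have := intervalIntegral.norm_integral_le_of_norm_le_const (a := (0 : ℝ)) (b := 2 * Real.pi)
      (C := ‖h - g‖) (f := fun s : ℝ => h (s : AddCircle (2 * Real.pi)) - g s)
      (fun x _ => (h - g).norm_coe_le_norm _)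
    have h2 : ‖(2 * Real.pi : ℂ)⁻¹‖ = (2 * Real.pi)⁻¹ := by
      simp [abs_of_pos Real.pi_pos]
    rw [sub_zero, abs_of_pos (by positivity)] at this
    rw [h2, inv_mul_le_iff₀ (by positivity)]
    linarith
  filter_upwards [Metric.tendsto_nhds.1 (hspan g hg) (ε / 3) (by positivity)] with t ht
  have := dist_triangle4 (∫ x, h ((x * t : ℝ) : AddCircle (2 * Real.pi)) ∂ν)
    (∫ x, g ((x * t : ℝ) : AddCircle (2 * Real.pi)) ∂ν)
    ((2 * Real.pi : ℂ)⁻¹ * ∫ s in (0 : ℝ)..2 * Real.pi, g (s : AddCircle (2 * Real.pi)))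
    ((2 * Real.pi : ℂ)⁻¹ * ∫ s in (0 : ℝ)..2 * Real.pi, h (s : AddCircle (2 * Real.pi)))
  linarith [hb1 t]

/-- If `x` has an absolutely continuous law, then `x * t` equidistributes modulo `2π` as
`t → ∞`. -/
theorem tendsto_integral_periodic (hν : ν ≪ volume) {g : ℝ → ℝ} (hg : Continuous g)
    (hp : Function.Periodic g (2 * Real.pi)) :
    Tendsto (fun t : ℝ => ∫ x, g (x * t) ∂ν) atTop
      (𝓝 ((2 * Real.pi)⁻¹ * ∫ s in (0 : ℝ)..2 * Real.pi, g s)) := by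
  have : Fact (0 < 2 * Real.pi) := ⟨by positivity⟩
  have hp' : Function.Periodic (fun x => (g x : ℂ)) (2 * Real.pi) := fun x => by
    simp only [hp x]
  let h : C(AddCircle (2 * Real.pi), ℂ) :=
    ⟨hp'.lift, continuous_coinduced_dom.2 (Complex.continuous_ofReal.comp hg)⟩
  have key := (Complex.continuous_re.tendsto _).comp (tendsto_integral_circle hν h)
  have e : ∀ x : ℝ, h (x : AddCircle (2 * Real.pi)) = (g x : ℂ) := fun x => hp'.lift_coe x
  simp only [e, Function.comp_def, integral_complex_ofReal, intervalIntegral.integral_ofReal,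
    Complex.ofReal_re] at key
  convert key using 2
  rw [← Complex.ofReal_re ((2 * Real.pi)⁻¹ * ∫ s in (0 : ℝ)..2 * Real.pi, g s)]
  push_cast
  rfl

end Equidistribution

/-! ### The long time and classical limits -/

section Limits

variable {S : Type*} [MeasurableSpace S] {P : Measure S}
  {m ω : S → ℝ} {c ħ : ℝ}

/-- The evolved Wigner function of a random oscillator, in terms of the classical flow. -/
theorem wigner_evolution_ae_eq (hω : ∀ᵐ a ∂P, 0 < ω a) (hc : 0 < c)
    (hmω : ∀ᵐ a ∂P, m a * ω a = c) (hħ : 0 < ħ) (Ψ : L2R) (t : ℝ) (z : ℝ × ℝ) :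
    (fun a => wigner ħ (evolution ħ (m a) (ω a) t Ψ) z) =ᵐ[P]
      fun a => wigner ħ Ψ (oscFlow c 1 (-(ω a * t)) z) := by
  filter_upwards [hω, hmω] with a h1 h2
  -- Positivity of the mass is forced by `m * ω = c > 0` and `ω > 0`.
  have hm : 0 < m a := pos_of_mul_pos_left (h2 ▸ hc) h1.le
  rw [wigner_evolution hħ hm h1, oscFlow_eq h2, mul_neg]

theorem continuous_wigner_oscFlow (hħ : 0 < ħ) (Ψ : L2R) (c t : ℝ) :
    Continuous fun q : ℝ × (ℝ × ℝ) => wigner ħ Ψ (oscFlow c 1 (-(q.1 * t)) q.2) :=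
  (continuous_wigner hħ Ψ).comp ((contDiff_oscFlow c (n := 0)).continuous.comp
    (f := fun q : ℝ × (ℝ × ℝ) => (-(q.1 * t), q.2)) (by fun_prop))

theorem integrable_wigner_evolution [IsProbabilityMeasure P]
    (hωm : AEMeasurable ω P) (hω : ∀ᵐ a ∂P, 0 < ω a) (hc : 0 < c)
    (hmω : ∀ᵐ a ∂P, m a * ω a = c) (hħ : 0 < ħ) (Ψ : L2R) (t : ℝ) (z : ℝ × ℝ) :
    Integrable (fun a => wigner ħ (evolution ħ (m a) (ω a) t Ψ) z) P := by
  refine Integrable.congr ?_ (wigner_evolution_ae_eq hω hc hmω hħ Ψ t z).symm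
  refine Integrable.of_bound ?_ ((Real.pi * ħ)⁻¹ * ‖Ψ‖ ^ 2)
    (Eventually.of_forall fun a => abs_wigner_le hħ Ψ _)
  have h : Continuous fun s => wigner ħ Ψ (oscFlow c 1 (-(s * t)) z) :=
    (continuous_wigner_oscFlow hħ Ψ c t).comp (f := fun s : ℝ => (s, z)) (by fun_prop)
  exact (h.measurable.comp_aemeasurable hωm).aestronglyMeasurable

/-- The long time limit of the averaged Wigner function is its orbit average. -/
theorem weakStarTendsto_integral_wigner_evolution [IsProbabilityMeasure P]
    (hωm : AEMeasurable ω P)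
    (hωa : P.map ω ≪ volume) (hω : ∀ᵐ a ∂P, 0 < ω a) (hc : 0 < c)
    (hmω : ∀ᵐ a ∂P, m a * ω a = c) (hħ : 0 < ħ) (Ψ : L2R) :
    WeakStarTendsto (fun (t : ℝ) (z : ℝ × ℝ) =>
      ∫ a, wigner ħ (evolution ħ (m a) (ω a) t Ψ) z ∂P) atTop (orbitAverage c (wigner ħ Ψ)) := by
  set ν : Measure ℝ := P.map ω with hν
  have : IsProbabilityMeasure ν := Measure.isProbabilityMeasure_map hωm
  set C : ℝ := (Real.pi * ħ)⁻¹ * ‖Ψ‖ ^ 2 with hC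
  have hz : ∀ t z, Continuous fun s => wigner ħ Ψ (oscFlow c 1 (-(s * t)) z) := fun t z =>
    (continuous_wigner_oscFlow hħ Ψ c t).comp (f := fun s : ℝ => (s, z)) (by fun_prop)
  have hE : ∀ t z, ∫ a, wigner ħ (evolution ħ (m a) (ω a) t Ψ) z ∂P =
      ∫ s, wigner ħ Ψ (oscFlow c 1 (-(s * t)) z) ∂ν := fun t z => by
    rw [integral_congr_ae (wigner_evolution_ae_eq hω hc hmω hħ Ψ t z), hν,
      integral_map hωm (hz t z).aestronglyMeasurable]
  simp only [hE]
  have hcont : ∀ t, Continuous fun z => ∫ s, wigner ħ Ψ (oscFlow c 1 (-(s * t)) z) ∂ν := fun t =>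
    continuous_of_dominated (bound := fun _ => C) (fun z => (hz t z).aestronglyMeasurable)
      (fun z => Eventually.of_forall fun s => abs_wigner_le hħ Ψ _) (integrable_const C)
      (Eventually.of_forall fun s => (continuous_wigner_oscFlow hħ Ψ c t).comp
        (f := fun z : ℝ × ℝ => (s, z)) (by fun_prop))
  refine ⟨Eventually.of_forall fun t => (hcont t).locallyIntegrable,
    (continuous_orbitAverage c (continuous_wigner hħ Ψ)).locallyIntegrable, fun f hf => ?_⟩
  have hfc : Continuous f := hf.1.continuous
  -- Convergence is pointwise in `z`, and `C` bounds the averaged Wigner functions uniformly in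
  -- time.
  refine tendsto_integral_filter_of_dominated_convergence (fun z => ‖f z‖ * C)
    (Eventually.of_forall fun t => (hfc.mul (hcont t)).aestronglyMeasurable)
    (Eventually.of_forall fun t => Eventually.of_forall fun z => ?_)
    ((hfc.integrable_of_hasCompactSupport hf.2).norm.mul_const C)
    (Eventually.of_forall fun z => ?_)
  · rw [norm_mul]
    gcongr
    refine (norm_integral_le_of_norm_le_const (C := C)
      (Eventually.of_forall fun s => abs_wigner_le hħ Ψ _)).trans_eq ?_
    simp
  · refine Tendsto.const_mul _ ?_
    rw [orbitAverage_eq_neg]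
    refine tendsto_integral_periodic hωa (g := fun s => wigner ħ Ψ (oscFlow c 1 (-s) z)) ?_ ?_
    · exact (continuous_wigner hħ Ψ).comp ((contDiff_oscFlow c (n := 0)).continuous.comp
        (f := fun s : ℝ => (-s, z)) (by fun_prop))
    · intro s
      have h := oscFlow_periodic c z (-(s + 2 * Real.pi))
      simp only [neg_add, neg_add_cancel_right] at h
      simp only [neg_add, h]

/-- Orbit averages of Wigner functions converge in the classical limit. -/
theorem IsClassicalLimit.weakStarTendsto_orbitAverage {Ψ : ℝ → L2R} {μ₀ : Measure (ℝ × ℝ)}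
    (hμ₀ : IsClassicalLimit Ψ μ₀) {W₀ : ℝ × ℝ → ℝ} (hW₀m : AEMeasurable W₀ volume)
    (hW₀ : 0 ≤ᵐ[volume] W₀)
    (hμW : μ₀ = (volume : Measure (ℝ × ℝ)).withDensity fun z => ENNReal.ofReal (W₀ z))
    (hc : 0 < c) :
    WeakStarTendsto (fun ħ => orbitAverage c (wigner ħ (Ψ ħ))) (𝓝[>] 0) (orbitAverage c W₀) := by
  have hp : IsProbabilityMeasure μ₀ := hμ₀.1
  -- The density is integrable because `μ₀` has total mass one.
  have hint : Integrable W₀ volume := by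
    rw [← lintegral_ofReal_ne_top_iff_integrable hW₀m.aestronglyMeasurable hW₀]
    have h1 : μ₀ univ = 1 := measure_univ
    rw [hμW, withDensity_apply _ MeasurableSet.univ, Measure.restrict_univ] at h1
    rw [h1]
    exact ENNReal.one_ne_top
  refine ⟨?_, locallyIntegrable_orbitAverage hc hint.locallyIntegrable, fun f hf => ?_⟩
  · filter_upwards [self_mem_nhdsWithin] with ħ hħ
    exact (continuous_orbitAverage c (continuous_wigner hħ _)).locallyIntegrable
  · have h := hμ₀.2 _ (hf.orbitAverage hc)
    have h2 : ∫ z, orbitAverage c f z ∂μ₀ = ∫ z, f z * orbitAverage c W₀ z := by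
      rw [integral_mul_orbitAverage hc hf.1.continuous hf.2 hint.locallyIntegrable, hμW,
        integral_withDensity_eq_integral_toReal_smul₀ hW₀m.ennreal_ofReal
          (Eventually.of_forall fun _ => ENNReal.ofReal_lt_top)]
      refine integral_congr_ae ?_
      filter_upwards [hW₀] with z hz
      rw [ENNReal.toReal_ofReal hz, smul_eq_mul, mul_comm]
    rw [h2] at h
    refine h.congr' ?_
    filter_upwards [self_mem_nhdsWithin] with ħ hħ
    rw [integral_mul_orbitAverage hc hf.1.continuous hf.2
      (continuous_wigner hħ _).locallyIntegrable]

end Limits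

end QHO

theorem mainTheorem1 {S : Type*} [MeasurableSpace S] (P : Measure S) [IsProbabilityMeasure P]
    (m ω : S → ℝ) (hm : AEMeasurable m P)
    -- `ω` has a density with respect to Lebesgue measure on `(0, ∞)`
    (hω : HasPDF ω P (volume.restrict (Set.Ioi (0 : ℝ))))
    (c : ℝ) (hc : 0 < c) (hmω : ∀ᵐ a ∂P, m a * ω a = c)
    (Ψ : ℝ → QHO.L2R) (μ₀ : Measure (ℝ × ℝ)) (hμ₀ : QHO.IsClassicalLimit Ψ μ₀)
    (W₀ : ℝ × ℝ → ℝ) (hW₀m : AEMeasurable W₀ volume) (hW₀ : 0 ≤ᵐ[volume] W₀)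
    (hμW : μ₀ = (volume : Measure (ℝ × ℝ)).withDensity fun z => ENNReal.ofReal (W₀ z)) :
    -- the time-evolved Wigner function at each point is an integrable random variable
    (∀ ħ : ℝ, 0 < ħ → ∀ (t : ℝ) (z : ℝ × ℝ),
      Integrable (fun a => QHO.wigner ħ (QHO.evolution ħ (m a) (ω a) t (Ψ ħ)) z) P) ∧
    -- the limit `t → ∞` exists for every `ħ > 0`, and then the limit `ħ → 0⁺` is the orbit average
    ∃ V : ℝ → ℝ × ℝ → ℝ,
      (∀ ħ : ℝ, 0 < ħ →
        QHO.WeakStarTendsto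
          (fun (t : ℝ) (z : ℝ × ℝ) =>
            ∫ a, QHO.wigner ħ (QHO.evolution ħ (m a) (ω a) t (Ψ ħ)) z ∂P)
          atTop (V ħ)) ∧
      QHO.WeakStarTendsto V (𝓝[>] 0) (QHO.orbitAverage c W₀) := by
  have hωm : AEMeasurable ω P := HasPDF.aemeasurable ω P (volume.restrict (Ioi (0 : ℝ)))
  -- This yields both `ω > 0` almost surely and absolute continuity with respect to Lebesgue measure
  -- on the whole line.
  have hac : P.map ω ≪ volume.restrict (Ioi (0 : ℝ)) := HasPDF.absolutelyContinuous
  have hpos : ∀ᵐ a ∂P, 0 < ω a :=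
    ae_of_ae_map hωm (hac.ae_le (ae_restrict_mem measurableSet_Ioi))
  exact ⟨fun ħ hħ t z => QHO.integrable_wigner_evolution hωm hpos hc hmω hħ (Ψ ħ) t z,
    fun ħ => QHO.orbitAverage c (QHO.wigner ħ (Ψ ħ)),
    fun ħ hħ => QHO.weakStarTendsto_integral_wigner_evolution hωm
      (hac.trans Measure.absolutelyContinuous_restrict) hpos hc hmω hħ (Ψ ħ),
    hμ₀.weakStarTendsto_orbitAverage hW₀m hW₀ hμW hc⟩
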